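/- Fix $d\ge 1$. **Model.** A 0-1 kinetically constrained spin model (0-1 KCSM) on $\mathbb Z^d$ is given by influence classes $\{\mathcal C_x\}_{x\in\mathbb Z^d}$, each $\mathcal C_x$ being a collection of subsets of $\mathbb Z^d$, such that (i) $x\notin A$ for all $A\in\mathcal C_x$; (ii) $\mathcal C_x=\mathcal C_0+x$; (iii) for some integer $r\ge 0$ (the range), every $A\in\mathcal C_x$ is contained in $\{y: 1\le \|x-y\|_1\le r\}$. Let $q\in(0,1)$, let $\nu$ be the law on $\{0,1\}$ with $\nu(0)=q$, $\nu(1)=1-q$, and let $\mu=\prod_{x}\nu$ on $\Omega=\{0,1\}^{\mathbb Z^d}$; write $\mu_\Lambda$ for the product measure on $\{0,1\}^\Lambda$. Put $c_x(\omega)=1$ if there is $A\in\mathcal C_x$ with $\omega_y=0$ for all $y\in A$, and $c_x(\omega)=0$ otherwise. **Generator and gap.** Let $\mathcal L$ be the closure in $L^2(\mu)$ of the operator $f\mapsto\sum_x c_x(\nu_x(f)-f)$ on functions $f$ of finitely many spins, where $\nu_x(f)$ is the average of $f$ over $\omega_x$ with respect to $\nu$. Let $\mathcal D(f)=\sum_{x}\mu\big(c_x\,\mathrm{Var}_x(f)\big)$,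 where $\mathrm{Var}_x$ is the variance with respect to $\omega_x$, the other spins being fixed, and $$\mathrm{gap}(\mathcal L)=\inf\Big\{\frac{\mathcal D(f)}{\mathrm{Var}_\mu(f)}:\ f\in Dom(\mathcal L),\ f\ne\text{const}\Big\}.$$ **Finite volume.** For finite $\Lambda\subset\mathbb Z^d$ and $\tau\in\Omega$, the chain in $\Lambda$ with boundary condition $\tau$ is the continuous-time Markov chain on $\{0,1\}^\Lambda$ in which every $x\in\Lambda$, at rate $c_x(\sigma\cdot\tau)$, refreshes its spin with a new value sampled from $\nu$; here $\sigma\cdot\tau$ equals $\sigma$ in $\Lambda$ and $\tau$ outside. It is ergodic if it is irreducible on $\{0,1\}^\Lambda$. A legal move at $x$ changes the spin at $x$ in a configuration $\omega$ with $c_x(\omega)=1$. **Good sets.** Let $\ell>r$ be an integer, $\Lambda_0=\{0,\dots,\ell-1\}^d$, $\Lambda_{\ell x}=\Lambda_0+\ell x$, and $\mathcal K_0^*=\{0,1\}^d\setminus\{0\}$. For $\epsilon\in(0,1)$, a set $G_\ell\subset\{0,1\}^{\Lambda_0}$ is *$\epsilon$-good on scale $\ell$* if (a) $\mu_{\Lambda_0}(G_\ell)\ge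 1-\epsilon$; (b) for every $\xi\in\Omega$ whose restriction to $\Lambda_{\ell x}$ (translated to $\Lambda_0$) belongs to $G_\ell$ for all $x\in\mathcal K_0^*$, there is a finite sequence of legal moves at sites of $\bigcup_{x\in\mathcal K_0^*}\Lambda_{\ell x}$ which transforms $\xi$ into a configuration $\tau$ such that the chain in $\Lambda_0$ with boundary condition $\tau$ is ergodic. **Theorem.** There exists a constant $\epsilon_0\in(0,1)$, depending only on the dimension $d$, such that for every 0-1 KCSM on $\mathbb Z^d$ and every $q\in(0,1)$: if there exist an integer $\ell>r$ and an $\epsilon_0$-good set $G_\ell$ on scale $\ell$, then $\mathrm{gap}(\mathcal L)>0$. -/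

import Mathlib

open MeasureTheory ProbabilityTheory Filter Topology
open scoped ENNReal

noncomputable section

/-- Sites of the lattice `ℤ^d`. -/
abbrev Site (d : ℕ) : Type := Fin d → ℤ

/-- Configurations in `{0,1}^V`; the value `0` is the good ("empty") state. -/
abbrev Config (V : Type) : Type := V → Fin 2

/-- The graph (`ℓ¹`) distance on `ℤ^d`. -/
def l1Dist {d : ℕ} (x y : Site d) : ℤ := ∑ i, |y i - x i|

/-- The *-oriented neighbourhood `K*_x`: the sites `y ≠ x` of the form `y = x + ∑ αᵢ eᵢ` with every
`αᵢ` equal to `0` or `1`. -/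
def starOriented {d : ℕ} (x : Site d) : Set (Site d) :=
  {y | y ≠ x ∧ ∀ i, y i = x i ∨ y i = x i + 1}

/-- The block `Λ₀ = {x : 0 ≤ xᵢ ≤ ℓ - 1 for all i}`. -/
def block (d ℓ : ℕ) : Finset (Site d) := Fintype.piFinset fun _ => Finset.Icc 0 ((ℓ : ℤ) - 1)

/-- The translated block `Λ_{ℓ y} = Λ₀ + ℓ y`. -/
def blockAt {d : ℕ} (ℓ : ℕ) (y : Site d) : Set (Site d) :=
  {x | ∃ z ∈ block d ℓ, x = z + (ℓ : ℤ) • y}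

/-- The restriction of `ω` to the block `Λ_{ℓ y}`, read as a configuration on `Λ₀`. -/
def restrictBlock {d : ℕ} (ℓ : ℕ) (y : Site d) (ω : Config (Site d)) : Config (block d ℓ) :=
  fun z => ω (z.1 + (ℓ : ℤ) • y)

/-- The configuration `σ · τ`, equal to `σ` inside `Λ` and to `τ` outside `Λ`. -/
def glue {d : ℕ} (Λ : Finset (Site d)) (σ : Config Λ) (τ : Config (Site d)) : Config (Site d) :=
  fun x => if h : x ∈ Λ then σ ⟨x, h⟩ else τ x

/-- The single-site law `ν`: mass `q` on `0` and mass `1 - q` on `1`. -/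
abbrev siteLaw (q : unitInterval) : Measure (Fin 2) := bernoulliMeasure 0 1 q

/-- The product measure `∏ ν` on `{0,1}^V`. -/
abbrev productLaw (V : Type) (q : unitInterval) : Measure (Config V) :=
  Measure.infinitePi (fun _ : V => siteLaw q)

/-- The local variance at `x`: the variance of `f` under `ν` in the variable `ω x`,
with all other variables held fixed. -/
def localVar {d : ℕ} (q : unitInterval) (x : Site d) (f : Config (Site d) → ℝ)
    (ω : Config (Site d)) : ℝ :=
  ∫ s, f (Function.update ω x s) ^ 2 ∂(siteLaw q) -
    (∫ s, f (Function.update ω x s) ∂(siteLaw q)) ^ 2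

/-- A 0-1 kinetically constrained spin model on `ℤ^d`, given by its influence classes: a collection
`influence x` of subsets of `ℤ^d` for each site `x`, independent of `x`, translation invariant and
of finite range. -/
structure KCSM (d : ℕ) where
  influence : Site d → Set (Set (Site d))
  not_mem : ∀ x, ∀ A ∈ influence x, x ∉ A
  translation : ∀ x, influence x = (fun A : Set (Site d) => (fun y => y + x) '' A) '' influence 0
  range : ℕ
  finite_range : ∀ x, ∀ A ∈ influence x, ∀ y ∈ A, 1 ≤ l1Dist x y ∧ l1Dist x y ≤ (range : ℤ)

namespace KCSM

variable {d : ℕ}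

/-- The constraint at `x` is satisfied by `ω`: some `A` in the influence class of `x` is
entirely empty. -/
def Constraint (K : KCSM d) (x : Site d) (ω : Config (Site d)) : Prop :=
  ∃ A ∈ K.influence x, ∀ y ∈ A, ω y = 0

open Classical in
/-- The indicator `c_x(ω)` of the constraint. -/
def c (K : KCSM d) (x : Site d) (ω : Config (Site d)) : ℝ :=
  if K.Constraint x ω then 1 else 0

/-- A legal move inside `V`: the spin of one site of `V` at which the constraint is satisfied is
given a new value. -/
def LegalMove (K : KCSM d) (V : Set (Site d)) (ω ω' : Config (Site d)) : Prop :=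
  ∃ x ∈ V, K.Constraint x ω ∧ ∃ s, ω' = Function.update ω x s

open Classical in
/-- Jump rate from `σ` to `σ'` of the finite-volume chain in `Λ` with boundary condition `τ`:
each site `x ∈ Λ` refreshes its spin at rate `c_x(σ · τ)` with a new value sampled from `ν`. -/
def jumpRate (K : KCSM d) (q : unitInterval) (Λ : Finset (Site d)) (τ : Config (Site d))
    (σ σ' : Config Λ) : ℝ :=
  ∑ x : Λ, K.c x.1 (glue Λ σ τ) *
    ∑ s : Fin 2, if σ' = Function.update σ x s then (siteLaw q).real {s} else 0

/-- Ergodicity (irreducibility on all of `{0,1}^Λ`) of the finite-volume chain in `Λ` with boundary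
condition `τ`. -/
def IsErgodic (K : KCSM d) (q : unitInterval) (Λ : Finset (Site d)) (τ : Config (Site d)) : Prop :=
  ∀ σ σ' : Config Λ, Relation.ReflTransGen (fun a b => 0 < K.jumpRate q Λ τ a b) σ σ'

/-- `G` is an `ε`-good set of configurations on scale `ℓ`. -/
def IsGood (K : KCSM d) (q : unitInterval) (ℓ : ℕ) (ε : ℝ) (G : Set (Config (block d ℓ))) : Prop :=
  1 - ε ≤ (productLaw (block d ℓ) q).real G ∧
  ∀ ξ : Config (Site d), (∀ y ∈ starOriented (0 : Site d), restrictBlock ℓ y ξ ∈ G) →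
    ∃ τ : Config (Site d),
      Relation.ReflTransGen (K.LegalMove (⋃ y ∈ starOriented (0 : Site d), blockAt ℓ y)) ξ τ ∧
      K.IsErgodic q (block d ℓ) τ

/-- `f` depends on finitely many spins only. -/
def IsLocal (f : Config (Site d) → ℝ) : Prop :=
  ∃ Λ : Finset (Site d), DependsOn f (Λ : Set (Site d))

/-- The generator on a local function `f`: `∑_x c_x (ν_x(f) - f)`
(all but finitely many terms vanish). -/
def localGenerator (K : KCSM d) (q : unitInterval) (f : Config (Site d) → ℝ)
    (ω : Config (Site d)) : ℝ :=
  ∑' x, K.c x ω * (∫ s, f (Function.update ω x s) ∂(siteLaw q) - f ω)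

/-- `IsGenerator K q f g` says that `f` lies in the domain of the infinite-volume generator `L` and
that `L f = g`. Here `L` is the closure in `L²(μ)` of the generator on local functions, so `(f, g)`
is an `L²(μ) × L²(μ)` limit of pairs `(fₙ, L fₙ)` with `fₙ` local. -/
def IsGenerator (K : KCSM d) (q : unitInterval) (f g : Config (Site d) → ℝ) : Prop :=
  MemLp f 2 (productLaw (Site d) q) ∧ MemLp g 2 (productLaw (Site d) q) ∧
  ∃ F : ℕ → Config (Site d) → ℝ, (∀ n, IsLocal (F n)) ∧
    Tendsto (fun n => eLpNorm (F n - f) 2 (productLaw (Site d) q)) atTop (𝓝 0) ∧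
    Tendsto (fun n => eLpNorm (K.localGenerator q (F n) - g) 2 (productLaw (Site d) q)) atTop (𝓝 0)

/-- The domain of the infinite-volume generator. -/
def Dom (K : KCSM d) (q : unitInterval) : Set (Config (Site d) → ℝ) :=
  {f | ∃ g, K.IsGenerator q f g}

/-- The Dirichlet form `D(f) = ∑_x μ(c_x Var_x(f))`. -/
def dirichlet (K : KCSM d) (q : unitInterval) (f : Config (Site d) → ℝ) : ℝ≥0∞ :=
  ∑' x, ∫⁻ ω, ENNReal.ofReal (K.c x ω * localVar q x f ω) ∂(productLaw (Site d) q)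

/-- The infinite-volume spectral gap: the infimum of `D(f) / Var(f)` over all `f` in the domain of
the generator that are not `μ`-almost everywhere constant. -/
def gap (K : KCSM d) (q : unitInterval) : ℝ≥0∞ :=
  ⨅ f ∈ {f ∈ K.Dom q | ¬ ∃ a : ℝ, f =ᵐ[productLaw (Site d) q] fun _ => a},
    K.dirichlet q f / evariance f (productLaw (Site d) q)

end KCSM

end

/-! Cut the lattice into blocks of side ℓ and call a block x facilitated when every block of its
*-oriented neighbourhood is good. A Poincaré inequality for local functions, with a constant
independent of the support, follows from two ingredients.

Renormalisation: resampling whole facilitated blocks satisfies a Poincaré inequality with constant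
4. In the lexicographic order the neighbourhood of x consists of later blocks. The martingale
decomposition `fluct_biUnion_eq_sum` writes the variance as a sum of terms a_x, the mean variance
over block x after the later blocks are averaged out. Splitting according to whether x is
facilitated (`fluct_le_constrained_add`) bounds a_x by twice the constrained block variance plus 2δ
times the sum of a_z over x and its neighbours, where δ = 2^d ε bounds the probability of
non-facilitation. Each block occurs in at most 2^d of these sums, so for 4 · 4^d ε ≤ 1 the errors
amount to at most half the total and are absorbed (`fluct_le_four_mul_sum_constrained`).

Paths: from a configuration in which x is facilitated, legal moves near x lead to the same
configuration with block x emptied (`IsGood.reflTransGen`). The endpoint ignores the spins of block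
x, so the block variance is at most the mean square increment along such paths. Their length is
bounded in terms of d and ℓ, and each step is paid for by a term c_v Var_v
(`IsGood.avg_starInd_mul_le`).

The inequality extends from local functions to the domain of the generator because D(F) = -⟨F, LF⟩
makes the Dirichlet form continuous for convergence in the graph norm
(`evariance_le_mul_dirichlet`). -/

/-! ### Averages over finitely many spins -/

section Avg

set_option linter.unusedSectionVars false

variable {V : Type} [DecidableEq V]

/-- The configuration equal to `0` on `T ∩ A`, to `1` on `A \ T` and to `ω` off `A`. -/
def setZeros (A T : Finset V) (ω : Config V) : Config V :=
  fun v => if v ∈ A then (if v ∈ T then 0 else 1) else ω v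

/-- The average of `h` over the spins in `A`, each being `0` with probability `q`. -/
def avg (q : ℝ) (A : Finset V) : (Config V → ℝ) →ₗ[ℝ] (Config V → ℝ) where
  toFun h ω := ∑ T ∈ A.powerset, q ^ T.card * (1 - q) ^ (A.card - T.card) * h (setZeros A T ω)
  map_add' f g := by
    funext ω; simp [mul_add, Finset.sum_add_distrib]
  map_smul' c f := by
    funext ω
    simp only [Pi.smul_apply, smul_eq_mul, RingHom.id_apply, Finset.mul_sum]
    exact Finset.sum_congr rfl fun _ _ => by ring

theorem avg_apply (q : ℝ) (A : Finset V) (h : Config V → ℝ) (ω : Config V) :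
    avg q A h ω =
      ∑ T ∈ A.powerset, q ^ T.card * (1 - q) ^ (A.card - T.card) * h (setZeros A T ω) := rfl

theorem setZeros_congr {A T : Finset V} {ω ω' : Config V} (h : ∀ v ∉ A, ω v = ω' v) :
    setZeros A T ω = setZeros A T ω' := by
  funext v
  by_cases hv : v ∈ A <;> simp [setZeros, hv, h]

theorem setZeros_apply_of_notMem {A T : Finset V} {v : V} (hv : v ∉ A) (ω : Config V) :
    setZeros A T ω v = ω v := by simp [setZeros, hv]

theorem exists_setZeros_eq {A : Finset V} {ω ω' : Config V} (h : ∀ v ∉ A, ω' v = ω v) :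
    ∃ T ∈ A.powerset, setZeros A T ω = ω' := by
  refine ⟨A.filter fun v => ω' v = 0, by simp, ?_⟩
  funext v
  by_cases hv : v ∈ A
  · by_cases h0 : ω' v = 0
    · simp [setZeros, hv, h0]
    · simp only [setZeros, hv, Finset.mem_filter, h0]; simp; omega
  · simp [setZeros, hv, h]

/-- `h` does not depend on the spins in `A`. -/
def FreeOf (A : Finset V) (h : Config V → ℝ) : Prop := DependsOn h ((A : Set V)ᶜ)

theorem FreeOf.mono {A B : Finset V} {h : Config V → ℝ} (hh : FreeOf B h) (hAB : A ⊆ B) :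
    FreeOf A h := fun _ _ H => hh fun v hv => H v fun hv' => hv (hAB hv')

theorem FreeOf.setZeros {A : Finset V} {h : Config V → ℝ} (hh : FreeOf A h) (T : Finset V)
    (ω : Config V) : h (setZeros A T ω) = h ω :=
  hh fun v hv => setZeros_apply_of_notMem (by simpa using hv) ω

theorem FreeOf.mul {A : Finset V} {g h : Config V → ℝ} (hg : FreeOf A g) (hh : FreeOf A h) :
    FreeOf A (g * h) := fun x y H => by simp only [Pi.mul_apply]; rw [hg H, hh H]

theorem FreeOf.sub {A : Finset V} {g h : Config V → ℝ} (hg : FreeOf A g) (hh : FreeOf A h) :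
    FreeOf A (g - h) := fun x y H => by simp only [Pi.sub_apply]; rw [hg H, hh H]

theorem freeOf_const (A : Finset V) (a : ℝ) : FreeOf A (fun _ => a) := fun _ _ _ => rfl

theorem freeOf_one (A : Finset V) : FreeOf A 1 := freeOf_const A 1

theorem freeOf_avg (q : ℝ) (A : Finset V) (h : Config V → ℝ) : FreeOf A (avg q A h) := by
  intro x y H
  simp only [avg_apply]
  refine Finset.sum_congr rfl fun T _ => ?_
  rw [setZeros_congr (A := A) (T := T) (ω := x) (ω' := y) fun v hv => H v (by simpa using hv)]

theorem FreeOf.avg {A : Finset V} {h : Config V → ℝ} (hh : FreeOf A h) (q : ℝ) (B : Finset V) :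
    FreeOf A (avg q B h) := by
  intro x y H
  simp only [avg_apply]
  refine Finset.sum_congr rfl fun T _ => ?_
  congr 1
  refine hh fun v hv => ?_
  by_cases hB : v ∈ B <;> simp [_root_.setZeros, hB, H v hv]

theorem sum_weights (q : ℝ) (A : Finset V) :
    ∑ T ∈ A.powerset, q ^ T.card * (1 - q) ^ (A.card - T.card) = 1 := by
  rw [Finset.sum_pow_mul_eq_add_pow]; simp

theorem avg_mul_of_freeOf {A : Finset V} {g : Config V → ℝ} (hg : FreeOf A g) (q : ℝ)
    (h : Config V → ℝ) : avg q A (g * h) = g * avg q A h := by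
  funext ω
  simp only [avg_apply, Pi.mul_apply, hg.setZeros, Finset.mul_sum]
  exact Finset.sum_congr rfl fun _ _ => by ring

theorem avg_of_freeOf {A : Finset V} {g : Config V → ℝ} (hg : FreeOf A g) (q : ℝ) :
    avg q A g = g := by
  funext ω
  simp only [avg_apply, hg.setZeros, ← Finset.sum_mul, sum_weights, one_mul]

theorem avg_one (q : ℝ) (A : Finset V) : avg q A 1 = 1 := avg_of_freeOf (freeOf_one A) q

theorem avg_mul_of_freeOf_right {A : Finset V} {g : Config V → ℝ} (hg : FreeOf A g) (q : ℝ)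
    (h : Config V → ℝ) : avg q A (h * g) = avg q A h * g := by
  rw [mul_comm, avg_mul_of_freeOf hg, mul_comm]

theorem avg_singleton (q : ℝ) (x : V) (h : Config V → ℝ) (ω : Config V) :
    avg q {x} h ω = q * h (Function.update ω x 0) + (1 - q) * h (Function.update ω x 1) := by
  have e : ({x} : Finset V).powerset = {∅, {x}} := by
    ext T; simp [Finset.subset_singleton_iff]
  have h0 : setZeros {x} {x} ω = Function.update ω x 0 := by
    funext v; by_cases hv : v = x
    · subst hv; simp [setZeros]
    · simp [setZeros, hv]
  have h1 : setZeros {x} ∅ ω = Function.update ω x 1 := by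
    funext v; by_cases hv : v = x
    · subst hv; simp [setZeros]
    · simp [setZeros, hv]
  rw [avg_apply, e, Finset.sum_pair (by simp)]
  simp [h0, h1]; ring

theorem avg_insert (q : ℝ) {x : V} {A : Finset V} (hx : x ∉ A) (h : Config V → ℝ) :
    avg q (insert x A) h = avg q {x} (avg q A h) := by
  funext ω
  rw [avg_singleton, avg_apply, Finset.sum_powerset_insert hx, avg_apply, avg_apply,
    Finset.mul_sum, Finset.mul_sum, add_comm]
  refine congrArg₂ (· + ·) (Finset.sum_congr rfl fun T hT => ?_)
    (Finset.sum_congr rfl fun T hT => ?_)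
  all_goals
    have hTA := Finset.mem_powerset.1 hT
    have hxT : x ∉ T := fun h' => hx (hTA h')
    have hc := Finset.card_le_card hTA
  · have e : setZeros (insert x A) (insert x T) ω = setZeros A T (Function.update ω x 0) := by
      funext v; by_cases hv : v = x
      · subst hv; simp [setZeros, hx]
      · simp [setZeros, hv]
    rw [e, Finset.card_insert_of_notMem hx, Finset.card_insert_of_notMem hxT,
      Nat.add_sub_add_right, pow_succ]; ring
  · have e : setZeros (insert x A) T ω = setZeros A T (Function.update ω x 1) := by
      funext v; by_cases hv : v = x
      · subst hv; simp [setZeros, hx, hxT]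
      · simp [setZeros, hv]
    rw [e, Finset.card_insert_of_notMem hx, Nat.sub_add_comm hc, pow_succ]; ring

theorem avg_empty (q : ℝ) (h : Config V → ℝ) : avg q ∅ h = h := by
  funext ω; simp [avg_apply]; congr 1

theorem avg_avg (q : ℝ) (A B : Finset V) (h : Config V → ℝ) :
    avg q A (avg q B h) = avg q (A ∪ B) h := by
  induction A using Finset.induction_on with
  | empty => simp [avg_empty]
  | insert x A hx ih =>
    rw [avg_insert q hx, ih, Finset.insert_union]
    by_cases hxB : x ∈ A ∪ B
    · rw [Finset.insert_eq_of_mem hxB]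
      exact avg_of_freeOf ((freeOf_avg q _ h).mono (by simpa using hxB)) q
    · rw [avg_insert q hxB]

theorem avg_avg_of_subset (q : ℝ) {A B : Finset V} (hAB : A ⊆ B) (h : Config V → ℝ) :
    avg q B (avg q A h) = avg q B h := by
  rw [avg_avg, Finset.union_eq_left.2 hAB]

theorem avg_comm (q : ℝ) (A B : Finset V) (h : Config V → ℝ) :
    avg q A (avg q B h) = avg q B (avg q A h) := by
  rw [avg_avg, avg_avg, Finset.union_comm]

variable {q : ℝ}

theorem avg_mono (h0 : 0 ≤ q) (h1 : q ≤ 1) (A : Finset V) {g h : Config V → ℝ} (hgh : g ≤ h) :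
    avg q A g ≤ avg q A h := by
  intro ω
  simp only [avg_apply]
  have : 0 ≤ 1 - q := by linarith
  exact Finset.sum_le_sum fun T _ => mul_le_mul_of_nonneg_left (hgh _) (by positivity)

theorem avg_nonneg (h0 : 0 ≤ q) (h1 : q ≤ 1) (A : Finset V) {h : Config V → ℝ} (hh : 0 ≤ h) :
    0 ≤ avg q A h := by
  simpa using avg_mono h0 h1 A hh

theorem sq_avg_mul_le (h0 : 0 ≤ q) (h1 : q ≤ 1) (A : Finset V) (g h : Config V → ℝ) :
    avg q A (g * h) ^ 2 ≤ avg q A (g ^ 2) * avg q A (h ^ 2) := by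
  intro ω
  have hq : 0 ≤ 1 - q := by linarith
  simp only [Pi.pow_apply, Pi.mul_apply, avg_apply]
  refine Finset.sum_sq_le_sum_mul_sum_of_sq_le_mul _ (fun T _ => by positivity)
    (fun T _ => by positivity) fun T _ => le_of_eq (by ring)

theorem sq_avg_le (h0 : 0 ≤ q) (h1 : q ≤ 1) (A : Finset V) (h : Config V → ℝ) :
    avg q A h ^ 2 ≤ avg q A (h ^ 2) := by
  simpa [avg_one] using sq_avg_mul_le h0 h1 A 1 h

/-- A nonnegative function is controlled by its average. -/
theorem le_avg_of_eqOn_compl (h0 : 0 < q) (h1 : q < 1) {A : Finset V} {h : Config V → ℝ}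
    (hh : 0 ≤ h) {ω ω' : Config V} (hω : ∀ v ∉ A, ω' v = ω v) :
    h ω' ≤ ((q * (1 - q)) ^ A.card)⁻¹ * avg q A h ω := by
  have hq : 0 < 1 - q := by linarith
  obtain ⟨T, hT, rfl⟩ := exists_setZeros_eq hω
  have hc := Finset.card_le_card (Finset.mem_powerset.1 hT)
  rw [inv_mul_eq_div, le_div_iff₀ (by positivity), avg_apply]
  refine le_trans ?_ (Finset.single_le_sum (fun T _ => ?_) hT)
  -- Every configuration on A has weight at least (q(1-q))^|A|, since both exponents are at most
  -- |A|.
  · rw [mul_comm, mul_pow]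
    refine mul_le_mul_of_nonneg_right (mul_le_mul ?_ ?_ ?_ ?_) (hh _)
    · exact pow_le_pow_of_le_one h0.le h1.le hc
    · exact pow_le_pow_of_le_one hq.le (by linarith) (by omega)
    all_goals positivity
  · exact mul_nonneg (by positivity) (hh _)

end Avg

/-! ### A constrained Poincaré inequality for blocks -/

theorem sum_sum_le_mul_sum {I J : Type*} [DecidableEq J] {L : Finset I} {M : Finset J}
    {s : I → Finset J} (hs : ∀ x ∈ L, s x ⊆ M) {a : J → ℝ} (ha : ∀ z, 0 ≤ a z) {N : ℕ}
    (hN : ∀ z ∈ M, (L.filter fun x => z ∈ s x).card ≤ N) :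
    ∑ x ∈ L, ∑ z ∈ s x, a z ≤ N * ∑ z ∈ M, a z := by
  calc ∑ x ∈ L, ∑ z ∈ s x, a z
      = ∑ x ∈ L, ∑ z ∈ M, if z ∈ s x then a z else 0 := by
        refine Finset.sum_congr rfl fun x hx => ?_
        rw [← Finset.sum_filter]
        congr 1
        ext z
        simp only [Finset.mem_filter]
        exact ⟨fun h => ⟨hs x hx h, h⟩, And.right⟩
    _ = ∑ z ∈ M, ((L.filter fun x => z ∈ s x).card : ℝ) * a z := by
        rw [Finset.sum_comm]
        refine Finset.sum_congr rfl fun z _ => ?_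
        rw [← Finset.sum_filter, Finset.sum_const, nsmul_eq_mul]
    _ ≤ ∑ z ∈ M, (N : ℝ) * a z :=
        Finset.sum_le_sum fun z hz =>
          mul_le_mul_of_nonneg_right (by exact_mod_cast hN z hz) (ha z)
    _ = N * ∑ z ∈ M, a z := by rw [← Finset.mul_sum]

section Fluct

variable {V : Type} [DecidableEq V]

/-- The mean over the spins in `W` of the variance of `g` with respect to the spins in `A ⊆ W`. -/
def fluct (q : ℝ) (W A : Finset V) (g : Config V → ℝ) (ω : Config V) : ℝ :=
  avg q W ((g - avg q A g) ^ 2) ω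

variable {q : ℝ} {W A B : Finset V}

/-- Pythagoras: `avg q A g - k` is free of A, while `g - avg q A g` has zero average over A, so the
cross term vanishes. -/
theorem avg_sq_sub_eq_fluct_add (hA : A ⊆ W) (g : Config V → ℝ) {k : Config V → ℝ}
    (hk : FreeOf A k) (ω : Config V) :
    avg q W ((g - k) ^ 2) ω = fluct q W A g ω + avg q W ((avg q A g - k) ^ 2) ω := by
  have e : (g - k) ^ 2 = (g - avg q A g) ^ 2 + (avg q A g - k) ^ 2 +
      (2 : ℝ) • ((avg q A g - k) * (g - avg q A g)) := by
    funext ω; simp; ring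
  have z : avg q W ((avg q A g - k) * (g - avg q A g)) = 0 := by
    rw [← avg_avg_of_subset q hA, avg_mul_of_freeOf ((freeOf_avg q A g).sub hk), map_sub,
      avg_of_freeOf (freeOf_avg q A g), sub_self, mul_zero, map_zero]
  rw [e, map_add, map_add, map_smul, z]
  simp [fluct]

variable (h0 : 0 ≤ q) (h1 : q ≤ 1)
include h0 h1

theorem fluct_nonneg (g : Config V → ℝ) (ω : Config V) : 0 ≤ fluct q W A g ω :=
  avg_nonneg h0 h1 W (fun _ => sq_nonneg _) ω

theorem fluct_le_avg_sq_sub (hA : A ⊆ W) (g : Config V → ℝ) {k : Config V → ℝ} (hk : FreeOf A k)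
    (ω : Config V) : fluct q W A g ω ≤ avg q W ((g - k) ^ 2) ω := by
  rw [avg_sq_sub_eq_fluct_add hA g hk]
  have := avg_nonneg h0 h1 W (h := (avg q A g - k) ^ 2) (fun _ => sq_nonneg _) ω
  simp only [Pi.zero_apply] at this
  linarith

theorem fluct_add_le (f g : Config V → ℝ) (ω : Config V) :
    fluct q W A (f + g) ω ≤ 2 * fluct q W A f ω + 2 * fluct q W A g ω := by
  have : avg q W ((f + g - avg q A (f + g)) ^ 2) ≤
      avg q W ((2 : ℝ) • (f - avg q A f) ^ 2 + (2 : ℝ) • (g - avg q A g) ^ 2) := by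
    refine avg_mono h0 h1 W fun ω => ?_
    simp only [map_add, Pi.add_apply, Pi.sub_apply, Pi.pow_apply, Pi.smul_apply, smul_eq_mul]
    nlinarith [sq_nonneg (f ω - avg q A f ω - (g ω - avg q A g ω))]
  have := this ω
  rw [map_add (avg q W), map_smul, map_smul] at this
  exact this

-- Law of total variance: Pythagoras with the centring `avg q (A ∪ B) g`, which is free of B.
omit h0 h1 in
theorem fluct_union (hB : B ⊆ W) (g : Config V → ℝ) (ω : Config V) :
    fluct q W (A ∪ B) g ω = fluct q W B g ω + fluct q W A (avg q B g) ω := by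
  rw [fluct, avg_sq_sub_eq_fluct_add hB g
    ((freeOf_avg q (A ∪ B) g).mono Finset.subset_union_right), fluct, fluct, avg_avg]

theorem avg_sq_avg_le (hB : B ⊆ W) (g : Config V → ℝ) (ω : Config V) :
    avg q W (avg q B g ^ 2) ω ≤ avg q W (g ^ 2) ω := by
  rw [← avg_avg_of_subset q hB (g ^ 2)]
  exact avg_mono h0 h1 W (sq_avg_le h0 h1 B g) ω

/-- Averages commute and c passes through the average over A, so the fluctuation is itself a
B-average, to which Jensen applies. -/
theorem fluct_avg_mul_le (hB : B ⊆ W) (g : Config V → ℝ) {c : Config V → ℝ} (hc : FreeOf A c)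
    (ω : Config V) :
    fluct q W A (avg q B (c * g)) ω ≤ avg q W ((c * (g - avg q A g)) ^ 2) ω := by
  have e : avg q B (c * g) - avg q A (avg q B (c * g)) = avg q B (c * (g - avg q A g)) := by
    rw [avg_comm, avg_mul_of_freeOf hc, ← map_sub, mul_sub]
  rw [fluct, e]
  exact avg_sq_avg_le h0 h1 hB _ ω

theorem fluct_avg_le (hB : B ⊆ W) (g : Config V → ℝ) (ω : Config V) :
    fluct q W A (avg q B g) ω ≤ fluct q W A g ω := by
  simpa [fluct] using fluct_avg_mul_le h0 h1 (A := A) hB g (freeOf_one A) ω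

/-- Here X is a block, D its neighbourhood, A the other later blocks and c the indicator of
facilitation. Write f = c f + (1 - c) f. The first part yields the constrained variance because c is
free of X. In the second, the average over A acts on f alone because c is free of A, and
Cauchy–Schwarz over D gains the factor ε. -/
theorem fluct_le_constrained_add {X D : Finset V} (hX : X ⊆ W) (hD : D ⊆ W) (hA : A ⊆ W)
    {c : Config V → ℝ} (hcX : FreeOf X c) (hcA : FreeOf A c) (hcc : c * c = c) {ε : ℝ}
    (hε : ∀ ω, avg q D (1 - c) ω ≤ ε) (f : Config V → ℝ) (ω : Config V) :
    fluct q W X (avg q (D ∪ A) f) ω ≤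
      2 * avg q W (c * (f - avg q X f) ^ 2) ω + 2 * ε * fluct q W (X ∪ D) (avg q A f) ω := by
  have hDA : D ∪ A ⊆ W := Finset.union_subset hD hA
  have e : avg q (D ∪ A) f = avg q (D ∪ A) (c * f) + avg q (D ∪ A) ((1 - c) * f) := by
    rw [← map_add]; congr 1; ring
  set g := avg q A f with hg
  set h := avg q (X ∪ D) g with hh
  have hdX : FreeOf X (1 - c) := (freeOf_one X).sub hcX
  have hdA : FreeOf A (1 - c) := (freeOf_one A).sub hcA
  have bound1 : fluct q W X (avg q (D ∪ A) (c * f)) ω ≤ avg q W (c * (f - avg q X f) ^ 2) ω := by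
    refine (fluct_avg_mul_le h0 h1 hDA f hcX ω).trans_eq ?_
    rw [mul_pow, pow_two c, hcc]
  have bound2 : fluct q W X (avg q (D ∪ A) ((1 - c) * f)) ω ≤ ε * fluct q W (X ∪ D) g ω := by
    have e2 : avg q (D ∪ A) ((1 - c) * f) = avg q D ((1 - c) * g) := by
      rw [← avg_avg, avg_mul_of_freeOf hdA]
    -- Any centring free of X may replace the mean over X. This one turns g into its deviation from
    -- the mean over X ∪ D, so that a variance, not a second moment, remains.
    have hk : FreeOf X (avg q D ((1 - c) * h)) :=
      (hdX.mul ((freeOf_avg q _ g).mono Finset.subset_union_left)).avg q D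
    rw [e2]
    refine (fluct_le_avg_sq_sub h0 h1 hX _ hk ω).trans ?_
    rw [← map_sub, ← mul_sub]
    have h2 : avg q D ((1 - c) * (g - h)) ^ 2 ≤ ε • avg q D ((g - h) ^ 2) := by
      refine (sq_avg_mul_le h0 h1 D _ _).trans fun ω => ?_
      have e3 : (1 - c) ^ 2 = 1 - c := by linear_combination hcc
      rw [e3]
      exact mul_le_mul_of_nonneg_right (hε ω) (avg_nonneg h0 h1 D (fun _ => sq_nonneg _) ω)
    have := avg_mono h0 h1 W h2 ω
    rw [map_smul, avg_avg_of_subset q hD] at this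
    exact this
  rw [e]
  refine (fluct_add_le h0 h1 _ _ ω).trans ?_
  linarith

-- Martingale decomposition: peel off the smallest index with `fluct_union`, the remaining, larger
-- ones being averaged first.
omit h0 h1 in
theorem fluct_biUnion_eq_sum {I : Type*} [LinearOrder I] (b : I → Finset V) (S : Finset I)
    (hS : S.biUnion b ⊆ W) (g : Config V → ℝ) (ω : Config V) :
    fluct q W (S.biUnion b) g ω =
      ∑ x ∈ S, fluct q W (b x) (avg q ((S.filter (x < ·)).biUnion b) g) ω := by
  induction S using Finset.induction_on_min with
  | empty =>
    have : (0 : Config V → ℝ) ^ 2 = 0 := by simp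
    simp [fluct, avg_empty, this]
  | insert m S hm ih =>
    have hmS : m ∉ S := fun h => lt_irrefl _ (hm m h)
    rw [Finset.biUnion_insert] at hS ⊢
    rw [fluct_union (Finset.union_subset_right hS),
      ih (Finset.union_subset_right hS), Finset.sum_insert hmS, add_comm]
    congr 1
    · congr 3
      refine congrArg (fun s : Finset I => s.biUnion b) ?_
      ext z
      simp only [Finset.mem_filter, Finset.mem_insert]
      constructor
      · exact fun h => ⟨Or.inr h, hm z h⟩
      · rintro ⟨rfl | h, h'⟩
        · exact absurd h' (lt_irrefl _)
        · exact h
    · refine Finset.sum_congr rfl fun x hx => ?_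
      congr 3
      rw [Finset.filter_insert, if_neg (hm x hx).asymm]

/-- The constraint of x looks only at later blocks, so these have already been averaged out in the
martingale term a_x. This gives a closed system of inequalities for the a_x, summed with
multiplicity N. L holds the blocks on which f may depend; M also contains their neighbours, whose
terms vanish unless they lie in L. -/
theorem fluct_le_four_mul_sum_constrained {I : Type*} [LinearOrder I] [DecidableEq I] (b : I → Finset V)
    (hb : Pairwise fun x y => Disjoint (b x) (b y)) (nbr : I → Finset I)
    (hlt : ∀ x, ∀ z ∈ nbr x, x < z) (c : I → Config V → ℝ) (hcc : ∀ x, c x * c x = c x)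
    (hc : ∀ x, DependsOn (c x) ((nbr x).biUnion b : Set V)) {ε : ℝ}
    (hε : ∀ x ω, avg q ((nbr x).biUnion b) (1 - c x) ω ≤ ε) (hε0 : 0 ≤ ε)
    {L M : Finset I} (hLM : L ⊆ M) (hnM : ∀ x ∈ L, nbr x ⊆ M) {N : ℕ}
    (hN : ∀ z, (L.filter fun x => z ∈ insert x (nbr x)).card ≤ N) (hεN : 4 * ε * N ≤ 1)
    {f : Config V → ℝ} (hf : ∀ x ∈ M, x ∉ L → FreeOf (b x) f) (ω : Config V) :
    fluct q (M.biUnion b) (M.biUnion b) f ω ≤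
      4 * ∑ x ∈ L, avg q (M.biUnion b) (c x * (f - avg q (b x) f) ^ 2) ω := by
  set W := M.biUnion b with hW
  have hsub : ∀ S ⊆ M, S.biUnion b ⊆ W := fun S hS => Finset.biUnion_subset_biUnion_of_subset_left _ hS
  have hsub1 : ∀ x ∈ M, b x ⊆ W := fun x hx => Finset.subset_biUnion_of_mem b hx
  set T : I → Config V → ℝ := fun x => avg q ((M.filter (x < ·)).biUnion b) f with hT
  set a : I → ℝ := fun x => fluct q W (b x) (T x) ω with ha
  have ha0 : ∀ x, 0 ≤ a x := fun x => fluct_nonneg h0 h1 _ ω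
  have haL : ∀ x ∈ M, x ∉ L → a x = 0 := by
    intro x hx hxL
    change avg q W ((T x - avg q (b x) (T x)) ^ 2) ω = 0
    have hTx : FreeOf (b x) (T x) := (hf x hx hxL).avg q _
    rw [avg_of_freeOf hTx, sub_self, zero_pow two_ne_zero, map_zero]
    rfl
  have free : ∀ x, ∀ S : Finset I, Disjoint S (nbr x) → FreeOf (S.biUnion b) (c x) := by
    intro x S hS u v huv
    refine hc x fun i hi => huv i ?_
    simp only [Finset.coe_biUnion, Set.mem_iUnion, Finset.mem_coe, Set.mem_compl_iff,
      not_exists] at hi ⊢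
    obtain ⟨z, hz, hiz⟩ := hi
    intro y hy hiy
    have hyz : y ≠ z := fun h => Finset.disjoint_left.1 hS hy (h ▸ hz)
    exact Finset.disjoint_left.1 (hb hyz) hiy hiz
  have key : ∀ x ∈ L, a x ≤ 2 * avg q W (c x * (f - avg q (b x) f) ^ 2) ω +
      2 * ε * ∑ z ∈ insert x (nbr x), a z := by
    intro x hx
    set S := M.filter (x < ·) \ nbr x with hS
    have hSM : S ⊆ M := Finset.sdiff_subset.trans (Finset.filter_subset _ _)
    have hxx : FreeOf (b x) (c x) := by
      have := free x {x} (by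
        rw [Finset.disjoint_singleton_left]; exact fun h => lt_irrefl _ (hlt x x h))
      simpa using this
    have e1 : T x = avg q ((nbr x).biUnion b ∪ S.biUnion b) f := by
      rw [← Finset.union_biUnion, hS, Finset.union_sdiff_of_subset]
      intro z hz
      exact Finset.mem_filter.2 ⟨hnM x hx hz, hlt x z hz⟩
    have main := fluct_le_constrained_add h0 h1 (W := W) (hsub1 x (hLM hx))
      (hsub _ (hnM x hx)) (hsub S hSM) hxx (free x S Finset.sdiff_disjoint) (hcc x) (hε x) f ω
    rw [← e1] at main
    refine main.trans ?_
    have hins : insert x (nbr x) ⊆ M := Finset.insert_subset (hLM hx) (hnM x hx)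
    have : fluct q W (b x ∪ (nbr x).biUnion b) (avg q (S.biUnion b) f) ω ≤
        ∑ z ∈ insert x (nbr x), a z := by
      rw [← Finset.biUnion_insert, fluct_biUnion_eq_sum b _ (hsub _ hins)]
      refine Finset.sum_le_sum fun z hz => ?_
      -- R contains every block of M after z, so averaging over R is averaging `T z` further, which
      -- can only decrease the fluctuation.
      set R := (insert x (nbr x)).filter (z < ·) ∪ S with hR
      have hRM : R ⊆ M := Finset.union_subset ((Finset.filter_subset _ _).trans hins) hSM
      have hsup : M.filter (z < ·) ⊆ R := by
        intro w hw
        obtain ⟨hwM, hzw⟩ := Finset.mem_filter.1 hw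
        have hxz : x ≤ z := by
          rcases Finset.mem_insert.1 hz with rfl | h
          · exact le_rfl
          · exact (hlt x z h).le
        by_cases hwn : w ∈ nbr x
        · exact Finset.mem_union_left _
            (Finset.mem_filter.2 ⟨Finset.mem_insert_of_mem hwn, hzw⟩)
        · exact Finset.mem_union_right _
            (Finset.mem_sdiff.2 ⟨Finset.mem_filter.2 ⟨hwM, hxz.trans_lt hzw⟩, hwn⟩)
      rw [avg_avg, ← Finset.union_biUnion, ← hR,
        ← avg_avg_of_subset q (Finset.biUnion_subset_biUnion_of_subset_left b hsup) f]
      exact fluct_avg_le h0 h1 (hsub R hRM) _ ω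
    have := mul_le_mul_of_nonneg_left this (show 0 ≤ 2 * ε by positivity)
    linarith
  have total : fluct q W W f ω = ∑ x ∈ L, a x := by
    rw [fluct_biUnion_eq_sum b M subset_rfl]
    exact (Finset.sum_subset hLM fun x hx hxL => haL x hx hxL).symm
  have mult : ∑ x ∈ L, ∑ z ∈ insert x (nbr x), a z ≤ N * ∑ x ∈ L, a x := by
    rw [Finset.sum_subset hLM fun x hx hxL => haL x hx hxL]
    exact sum_sum_le_mul_sum (fun x hx => Finset.insert_subset (hLM hx) (hnM x hx)) ha0
      fun z _ => hN z
  have hsum := Finset.sum_le_sum key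
  rw [Finset.sum_add_distrib, ← Finset.mul_sum, ← Finset.mul_sum] at hsum
  have hA0 : 0 ≤ ∑ x ∈ L, a x := Finset.sum_nonneg fun x _ => ha0 x
  rw [total]
  -- Since 2εN ≤ 1/2, half of the total moves to the left; this turns the factor 2 into 4.
  have m2 := mul_le_mul_of_nonneg_left mult (show 0 ≤ 2 * ε by positivity)
  have m3 := mul_le_mul_of_nonneg_right hεN hA0
  linarith

end Fluct

/-! ### Paths of legal moves -/

/-- The increment bound is symmetric, so r may be read as an undirected graph; a path without
repeated vertices has fewer steps than there are states. -/
theorem abs_sub_le_card_mul_of_reflTransGen {S : Type*} [Fintype S] {r : S → S → Prop}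
    {f : S → ℝ} {R : ℝ} (hR : 0 ≤ R) (hr : ∀ u v, r u v → |f u - f v| ≤ R) {a b : S}
    (hab : Relation.ReflTransGen r a b) : |f a - f b| ≤ Fintype.card S * R := by
  classical
  have hadj : ∀ u v, (SimpleGraph.fromRel r).Adj u v → |f u - f v| ≤ R := by
    intro u v h
    rcases ((SimpleGraph.fromRel_adj r u v).1 h).2 with h | h
    · exact hr u v h
    · rw [abs_sub_comm]; exact hr v u h
  have hwalk : ∀ {u v : S} (p : (SimpleGraph.fromRel r).Walk u v),
      |f u - f v| ≤ p.length * R := by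
    intro u v p
    induction p with
    | nil => simp
    | cons h p ih =>
      rename_i u v w
      have := abs_sub_le (f u) (f v) (f w)
      have := hadj _ _ h
      rw [SimpleGraph.Walk.length_cons]
      push_cast
      linarith
  have hreach : (SimpleGraph.fromRel r).Reachable a b := by
    induction hab with
    | refl => rfl
    | tail _ h ih =>
      rename_i u v _
      refine ih.trans ?_
      by_cases huv : u = v
      · rw [huv]
      · exact SimpleGraph.Adj.reachable ((SimpleGraph.fromRel_adj r u v).2 ⟨huv, Or.inl h⟩)
  obtain ⟨p⟩ := hreach
  have hlt := p.toPath.2.length_lt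
  refine (hwalk p.toPath.1).trans (mul_le_mul_of_nonneg_right ?_ hR)
  exact_mod_cast hlt.le

/-! ### Geometry of blocks and *-oriented neighbourhoods -/

section Blocks

variable {d : ℕ}

/-- The block `Λ_{ℓ y}` as a finite set. -/
noncomputable def blockFinset (ℓ : ℕ) (y : Site d) : Finset (Site d) :=
  (block d ℓ).map (addRightEmbedding ((ℓ : ℤ) • y))

theorem mem_blockFinset {ℓ : ℕ} {y v : Site d} :
    v ∈ blockFinset ℓ y ↔ ∃ z ∈ block d ℓ, z + (ℓ : ℤ) • y = v := by
  simp [blockFinset]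

theorem coe_blockFinset (ℓ : ℕ) (y : Site d) : (blockFinset ℓ y : Set (Site d)) = blockAt ℓ y := by
  ext v
  simp only [Finset.mem_coe, mem_blockFinset, blockAt, Set.mem_ofPred_eq, eq_comm]

theorem mem_block {ℓ : ℕ} {z : Site d} : z ∈ block d ℓ ↔ ∀ i, 0 ≤ z i ∧ z i < ℓ := by
  simp only [block, Fintype.mem_piFinset, Finset.mem_Icc]
  exact forall_congr' fun i => by omega

theorem mem_blockFinset_iff_ediv {ℓ : ℕ} (hℓ : 0 < ℓ) {y v : Site d} :
    v ∈ blockFinset ℓ y ↔ ∀ i, v i / (ℓ : ℤ) = y i := by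
  have hℓ' : (0 : ℤ) < ℓ := by exact_mod_cast hℓ
  rw [mem_blockFinset]
  constructor
  · rintro ⟨z, hz, rfl⟩ i
    have := mem_block.1 hz i
    simp only [Pi.add_apply, Pi.smul_apply, smul_eq_mul]
    rw [Int.add_mul_ediv_left _ _ hℓ'.ne', Int.ediv_eq_zero_of_lt this.1 this.2, zero_add]
  · intro h
    refine ⟨v - (ℓ : ℤ) • y, mem_block.2 fun i => ?_, by simp⟩
    simp only [Pi.sub_apply, Pi.smul_apply, smul_eq_mul, ← h i]
    have := Int.emod_add_mul_ediv (v i) ℓ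
    have := Int.emod_nonneg (v i) hℓ'.ne'
    have := Int.emod_lt_of_pos (v i) hℓ'
    constructor <;> linarith

theorem blockFinset_pairwise_disjoint {ℓ : ℕ} (hℓ : 0 < ℓ) :
    Pairwise fun x y : Site d => Disjoint (blockFinset ℓ x) (blockFinset ℓ y) := by
  intro x y hxy
  rw [Finset.disjoint_left]
  intro v hx hy
  refine hxy (funext fun i => ?_)
  rw [← (mem_blockFinset_iff_ediv hℓ).1 hx i, (mem_blockFinset_iff_ediv hℓ).1 hy i]

theorem blockFinset_zero (ℓ : ℕ) : blockFinset ℓ (0 : Site d) = block d ℓ := by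
  ext v; simp [mem_blockFinset]

theorem card_blockFinset (ℓ : ℕ) (y : Site d) : (blockFinset ℓ y).card = ℓ ^ d := by
  simp [blockFinset, block, Fintype.card_piFinset]

/-- The *-oriented neighbourhood of `x`, as a finite set. -/
def starFinset (x : Site d) : Finset (Site d) :=
  (Fintype.piFinset fun i => {x i, x i + 1}).erase x

theorem mem_starFinset {x y : Site d} : y ∈ starFinset x ↔ y ∈ starOriented x := by
  simp [starFinset, starOriented]

theorem insert_starFinset (x : Site d) :
    insert x (starFinset x) = Fintype.piFinset fun i => {x i, x i + 1} :=
  Finset.insert_erase (by simp)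

theorem card_insert_starFinset (x : Site d) : (insert x (starFinset x)).card = 2 ^ d := by
  rw [insert_starFinset, Fintype.card_piFinset]
  simp

theorem card_filter_mem_insert_starFinset_le (L : Finset (Site d)) (z : Site d) :
    (L.filter fun x => z ∈ insert x (starFinset x)).card ≤ 2 ^ d := by
  have : (Fintype.piFinset fun i => ({z i - 1, z i} : Finset ℤ)).card = 2 ^ d := by
    rw [Fintype.card_piFinset]; simp
  rw [← this]
  refine Finset.card_le_card fun x hx => ?_
  have := (Finset.mem_filter.1 hx).2
  rw [insert_starFinset] at this
  simp only [Fintype.mem_piFinset, Finset.mem_insert, Finset.mem_singleton] at this ⊢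
  intro i
  have := this i
  omega

/-- The sites of the block at `x` and of the blocks of its *-oriented neighbourhood. -/
noncomputable def window (ℓ : ℕ) (x : Site d) : Finset (Site d) :=
  (insert x (starFinset x)).biUnion (blockFinset ℓ)

theorem card_window_le (ℓ : ℕ) (x : Site d) : (window ℓ x).card ≤ 2 ^ d * ℓ ^ d := by
  refine (Finset.card_biUnion_le_card_mul _ _ _ fun y _ => (card_blockFinset ℓ y).le).trans_eq ?_
  rw [card_insert_starFinset]

end Blocks

/-! ### Emptying a block whose neighbourhood is good -/

namespace KCSM

variable {d : ℕ} (K : KCSM d)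

theorem constraint_add {x t : Site d} {ω : Config (Site d)} :
    K.Constraint (x + t) ω ↔ K.Constraint x fun v => ω (v + t) := by
  unfold Constraint
  rw [K.translation (x + t), K.translation x]
  simp only [Set.exists_mem_image, Set.forall_mem_image, add_assoc]

theorem Constraint.update {K : KCSM d} {x : Site d} {ω : Config (Site d)} (h : K.Constraint x ω)
    (s : Fin 2) : K.Constraint x (Function.update ω x s) := by
  obtain ⟨A, hA, h⟩ := h
  refine ⟨A, hA, fun y hy => ?_⟩
  rw [Function.update_of_ne, h y hy]
  rintro rfl
  exact K.not_mem _ A hA hy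

/-- A legal move can be undone because the constraint at x ignores the spin at x, and emptying A can
only help constraints. -/
theorem LegalMove.setZeros_symm {K : KCSM d} {S : Set (Site d)} {A : Finset (Site d)}
    (hSA : ∀ v ∈ S, v ∉ A) {ω ω' : Config (Site d)} (h : K.LegalMove S ω ω') :
    K.LegalMove S (setZeros A A ω') (setZeros A A ω) := by
  obtain ⟨x, hx, hc, s, rfl⟩ := h
  refine ⟨x, hx, ?_, ω x, ?_⟩
  · obtain ⟨B, hB, h⟩ := hc.update s
    refine ⟨B, hB, fun y hy => ?_⟩
    by_cases hyA : y ∈ A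
    · simp [setZeros, hyA]
    · rw [setZeros_apply_of_notMem hyA, h y hy]
  · funext v
    by_cases hv : v = x
    · subst hv; simp [setZeros, hSA v hx]
    · simp [setZeros, hv]

theorem LegalMove.mono {K : KCSM d} {S T : Set (Site d)} (hST : S ⊆ T) {ω ω' : Config (Site d)}
    (h : K.LegalMove S ω ω') : K.LegalMove T ω ω' := by
  obtain ⟨x, hx, h⟩ := h
  exact ⟨x, hST hx, h⟩

theorem LegalMove.apply_eq {K : KCSM d} {S : Set (Site d)} {ω ω' : Config (Site d)}
    (h : K.LegalMove S ω ω') {v : Site d} (hv : v ∉ S) : ω' v = ω v := by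
  obtain ⟨x, hx, _, s, rfl⟩ := h
  exact Function.update_of_ne (by rintro rfl; exact hv hx) _ _

theorem apply_eq_of_reflTransGen_legalMove {K : KCSM d} {S : Set (Site d)}
    {ω ω' : Config (Site d)} (h : Relation.ReflTransGen (K.LegalMove S) ω ω') {v : Site d}
    (hv : v ∉ S) : ω' v = ω v := by
  induction h with
  | refl => rfl
  | tail _ h ih => rw [h.apply_eq hv, ih]

theorem legalMove_glue_of_jumpRate_pos {K : KCSM d} {q : unitInterval} {Λ : Finset (Site d)}
    {τ : Config (Site d)} {σ σ' : Config Λ} (h : 0 < K.jumpRate q Λ τ σ σ') :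
    K.LegalMove Λ (glue Λ σ τ) (glue Λ σ' τ) := by
  classical
  obtain ⟨x, -, hx⟩ := Finset.exists_lt_of_sum_lt (s := Finset.univ) (f := fun _ : Λ => (0 : ℝ))
    (by simpa [jumpRate] using h)
  have hc : K.Constraint x.1 (glue Λ σ τ) := by
    by_contra hc
    simp [c, hc] at hx
  obtain ⟨s, rfl⟩ : ∃ s, σ' = Function.update σ x s := by
    by_contra hs
    push Not at hs
    simp [hs] at hx
  refine ⟨x.1, x.2, hc, s, ?_⟩
  funext v
  by_cases hv : v = x.1
  · subst hv; simp [glue]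
  · by_cases hvΛ : v ∈ Λ
    · have : (⟨v, hvΛ⟩ : Λ) ≠ x := fun e => hv (congrArg Subtype.val e)
      simp [glue, hvΛ, hv, this]
    · simp [glue, hvΛ, hv]

/-- Move the neighbours to reach τ, use ergodicity to empty Λ₀, then undo the moves of the
neighbours with Λ₀ kept empty. The spins outside Λ₀ are thereby restored. -/
theorem IsGood.reflTransGen_zero {K : KCSM d} {q : unitInterval} {ℓ : ℕ} (hℓ : 0 < ℓ) {ε : ℝ}
    {G : Set (Config (block d ℓ))} (hG : K.IsGood q ℓ ε G) {ξ : Config (Site d)}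
    (hξ : ∀ y ∈ starOriented (0 : Site d), restrictBlock ℓ y ξ ∈ G) :
    Relation.ReflTransGen (K.LegalMove (window ℓ (0 : Site d))) ξ
      (setZeros (block d ℓ) (block d ℓ) ξ) := by
  obtain ⟨τ, hτ, herg⟩ := hG.2 ξ hξ
  set S : Set (Site d) := ⋃ y ∈ starOriented (0 : Site d), blockAt ℓ y with hS
  have hSW : S ⊆ window ℓ (0 : Site d) := by
    intro v hv
    simp only [hS, Set.mem_iUnion, ← coe_blockFinset, Finset.mem_coe] at hv
    obtain ⟨y, hy, hv⟩ := hv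
    exact Finset.mem_biUnion.2 ⟨y, Finset.mem_insert_of_mem (mem_starFinset.2 hy), hv⟩
  have hΛW : (block d ℓ : Set (Site d)) ⊆ window ℓ (0 : Site d) := by
    intro v hv
    exact Finset.mem_biUnion.2 ⟨0, Finset.mem_insert_self _ _, by rwa [blockFinset_zero]⟩
  have hSA : ∀ v ∈ S, v ∉ block d ℓ := by
    intro v hv hvΛ
    simp only [hS, Set.mem_iUnion, ← coe_blockFinset, Finset.mem_coe] at hv
    obtain ⟨y, hy, hv⟩ := hv
    rw [← blockFinset_zero] at hvΛ
    exact Finset.disjoint_left.1 (blockFinset_pairwise_disjoint hℓ hy.1) hv hvΛ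
  have p1 : Relation.ReflTransGen (K.LegalMove (window ℓ (0 : Site d))) ξ τ :=
    hτ.lift id fun _ _ h => h.mono hSW
  have p2 : Relation.ReflTransGen (K.LegalMove (window ℓ (0 : Site d))) τ
      (setZeros (block d ℓ) (block d ℓ) τ) := by
    have h := herg (fun v => τ v.1) fun _ => 0
    have := h.lift (fun σ => glue (block d ℓ) σ τ)
      fun _ _ h => (legalMove_glue_of_jumpRate_pos h).mono hΛW
    convert this using 1
    · funext v; simp [glue]
    · funext v; by_cases hv : v ∈ block d ℓ <;> simp [glue, setZeros, hv]
  have p3 : Relation.ReflTransGen (K.LegalMove (window ℓ (0 : Site d)))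
      (setZeros (block d ℓ) (block d ℓ) τ) (setZeros (block d ℓ) (block d ℓ) ξ) := by
    exact Relation.ReflTransGen.swap _ _ (hτ.lift (setZeros (block d ℓ) (block d ℓ))
      fun _ _ h => (h.setZeros_symm hSA).mono hSW)
  exact (p1.trans p2).trans p3

theorem LegalMove.translate {K : KCSM d} {S T : Set (Site d)} {t : Site d}
    (hST : ∀ v ∈ S, v + t ∈ T) {ω ω' : Config (Site d)} (h : K.LegalMove S ω ω') :
    K.LegalMove T (fun v => ω (v - t)) (fun v => ω' (v - t)) := by
  obtain ⟨x, hx, hc, s, rfl⟩ := h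
  refine ⟨x + t, hST x hx, ?_, s, ?_⟩
  · rw [constraint_add]; simpa using hc
  · funext v
    by_cases hv : v = x + t
    · subst hv; simp
    · have : v - t ≠ x := fun h => hv (by rw [← h]; simp)
      simp [hv, this]

theorem IsGood.reflTransGen {K : KCSM d} {q : unitInterval} {ℓ : ℕ} (hℓ : 0 < ℓ) {ε : ℝ}
    {G : Set (Config (block d ℓ))} (hG : K.IsGood q ℓ ε G) {x : Site d} {ω : Config (Site d)}
    (hω : ∀ y ∈ starFinset x, restrictBlock ℓ y ω ∈ G) :
    Relation.ReflTransGen (K.LegalMove (window ℓ x)) ω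
      (setZeros (blockFinset ℓ x) (blockFinset ℓ x) ω) := by
  set t : Site d := (ℓ : ℤ) • x with ht
  have h := hG.reflTransGen_zero hℓ (ξ := fun v => ω (v + t)) (by
    intro y hy
    have := hω (y + x) (by
      rw [mem_starFinset]
      refine ⟨by simpa using hy.1, fun i => ?_⟩
      have := hy.2 i
      simp only [Pi.zero_apply, Pi.add_apply] at this ⊢
      omega)
    convert this using 1
    funext v
    simp only [restrictBlock, ht, smul_add, add_assoc])
  have := h.lift (fun ω v => ω (v - t)) fun _ _ h => h.translate (T := window ℓ x) (t := t) (by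
    intro v hv
    simp only [window, Finset.coe_biUnion, Set.mem_iUnion, Finset.mem_coe,
      mem_blockFinset_iff_ediv hℓ, insert_starFinset, Fintype.mem_piFinset,
      Finset.mem_insert, Finset.mem_singleton, Pi.zero_apply] at hv ⊢
    obtain ⟨y, hy, hv⟩ := hv
    refine ⟨y + x, fun i => ?_, fun i => ?_⟩
    · have := hy i
      simp only [Pi.add_apply]
      omega
    · rw [Pi.add_apply, ht, Pi.smul_apply, smul_eq_mul,
        Int.add_mul_ediv_left _ _ (by exact_mod_cast hℓ.ne'), hv i, Pi.add_apply])
  convert this using 1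
  · funext v; simp
  · funext v
    have : v ∈ blockFinset ℓ x ↔ v - t ∈ block d ℓ := by
      rw [mem_blockFinset]
      constructor
      · rintro ⟨z, hz, rfl⟩; simpa [ht] using hz
      · exact fun h => ⟨v - t, h, by simp [ht]⟩
    by_cases hv : v - t ∈ block d ℓ <;> simp [setZeros, this, hv]

end KCSM

/-! ### The Poincaré inequality for local functions -/

section SpinVar

variable {V : Type} [DecidableEq V]

/-- The variance of `f` with respect to the spin at `x`. -/
def spinVar (q : ℝ) (x : V) (f : Config V → ℝ) (ω : Config V) : ℝ :=
  q * (1 - q) * (f (Function.update ω x 0) - f (Function.update ω x 1)) ^ 2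

theorem spinVar_nonneg {q : ℝ} (h0 : 0 ≤ q) (h1 : q ≤ 1) (x : V) (f : Config V → ℝ)
    (ω : Config V) : 0 ≤ spinVar q x f ω :=
  mul_nonneg (mul_nonneg h0 (by linarith)) (sq_nonneg _)

theorem sq_sub_update_le {q : ℝ} (h0 : 0 < q) (h1 : q < 1) (x : V) (f : Config V → ℝ)
    (ω : Config V) (s : Fin 2) :
    (f ω - f (Function.update ω x s)) ^ 2 ≤ (q * (1 - q))⁻¹ * spinVar q x f ω := by
  have hq : 0 < 1 - q := by linarith
  have e : (q * (1 - q))⁻¹ * spinVar q x f ω =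
      (f (Function.update ω x 0) - f (Function.update ω x 1)) ^ 2 := by
    rw [spinVar, inv_mul_cancel_left₀ (by positivity)]
  rw [e]
  have two : ∀ t : Fin 2, t = 0 ∨ t = 1 := by decide
  have hω : f ω = f (Function.update ω x (ω x)) := by rw [Function.update_eq_self]
  rw [hω]
  generalize ω x = t
  rcases two t with rfl | rfl <;> rcases two s with rfl | rfl
  · simpa using sq_nonneg _
  · exact le_rfl
  · exact le_of_eq (by ring)
  · simpa using sq_nonneg _

end SpinVar

/-! ### Comparison of block variances with single-spin energies -/

namespace KCSM

variable {d : ℕ} {K : KCSM d}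

theorem c_nonneg (K : KCSM d) (x : Site d) (ω : Config (Site d)) : 0 ≤ K.c x ω := by
  unfold c; split_ifs <;> norm_num

theorem c_le_one (K : KCSM d) (x : Site d) (ω : Config (Site d)) : K.c x ω ≤ 1 := by
  unfold c; split_ifs <;> norm_num

theorem c_of_constraint {x : Site d} {ω : Config (Site d)} (h : K.Constraint x ω) :
    K.c x ω = 1 := if_pos h

theorem reflTransGen_glue {W : Finset (Site d)} {ω ω' : Config (Site d)}
    (h : Relation.ReflTransGen (K.LegalMove W) ω ω') :
    Relation.ReflTransGen
      (fun σ σ' : Config W => K.LegalMove W (glue W σ ω) (glue W σ' ω))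
      (fun v => ω v) (fun v => ω' v) := by
  have hglue : ∀ u, Relation.ReflTransGen (K.LegalMove W) ω u →
      glue W (fun v => u v) ω = u := by
    intro u hu
    funext v
    by_cases hv : v ∈ W
    · simp [glue, hv]
    · simp [glue, hv, apply_eq_of_reflTransGen_legalMove hu (v := v) (by simpa using hv)]
  induction h with
  | refl => exact .refl
  | tail h1 h2 ih =>
    refine ih.tail ?_
    rw [hglue _ h1, hglue _ (h1.tail h2)]
    exact h2

/-- Moving along legal moves costs at most the local Dirichlet form, up to a constant. -/
theorem sq_sub_le_of_reflTransGen_legalMove {q : ℝ} (h0 : 0 < q) (h1 : q < 1)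
    {W : Finset (Site d)} {ω ω' : Config (Site d)}
    (h : Relation.ReflTransGen (K.LegalMove W) ω ω') (F : Config (Site d) → ℝ) :
    (F ω - F ω') ^ 2 ≤ ((2 : ℝ) ^ W.card) ^ 2 *
      ((q * (1 - q))⁻¹ * ((q * (1 - q)) ^ W.card)⁻¹ *
        avg q W (∑ v ∈ W, K.c v * spinVar q v F) ω) := by
  have hq : 0 < 1 - q := by linarith
  set H : Config (Site d) → ℝ := ∑ v ∈ W, K.c v * spinVar q v F with hH
  have hterm : ∀ v u, 0 ≤ K.c v u * spinVar q v F u := fun v u =>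
    mul_nonneg (K.c_nonneg v u) (spinVar_nonneg h0.le h1.le v F u)
  have hH0 : 0 ≤ H := by
    intro u
    simp only [hH, Finset.sum_apply, Pi.mul_apply]
    exact Finset.sum_nonneg fun v _ => hterm v u
  set Q : ℝ := (q * (1 - q))⁻¹ * ((q * (1 - q)) ^ W.card)⁻¹ * avg q W H ω with hQ
  have hQ0 : 0 ≤ Q := mul_nonneg (by positivity) (avg_nonneg h0.le h1.le W hH0 ω)
  have hr : ∀ σ σ' : Config W, K.LegalMove W (glue W σ ω) (glue W σ' ω) →
      |F (glue W σ ω) - F (glue W σ' ω)| ≤ √Q := by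
    rintro σ σ' ⟨x, hx, hc, s, hs⟩
    refine Real.abs_le_sqrt ?_
    rw [hs]
    refine (sq_sub_update_le h0 h1 x F _ s).trans ?_
    rw [hQ, mul_assoc]
    refine mul_le_mul_of_nonneg_left ?_ (by positivity)
    -- Intermediate configurations agree with ω off W, so the energy at each of them is controlled
    -- by its average over W.
    refine le_trans ?_ (le_avg_of_eqOn_compl h0 h1 hH0 (ω' := glue W σ ω) fun v hv => by
      simp [glue, hv])
    simp only [hH, Finset.sum_apply, Pi.mul_apply]
    refine le_trans (le_of_eq ?_) (Finset.single_le_sum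
      (f := fun v => K.c v (glue W σ ω) * spinVar q v F (glue W σ ω))
      (fun v _ => hterm v _) hx)
    simp [c_of_constraint hc]
  have main := abs_sub_le_card_mul_of_reflTransGen (f := fun σ : Config W => F (glue W σ ω))
    (Real.sqrt_nonneg Q) hr (reflTransGen_glue h)
  have e1 : glue W (fun v => ω v) ω = ω := by funext v; simp [glue]
  have e2 : glue W (fun v => ω' v) ω = ω' := by
    funext v
    by_cases hv : v ∈ W
    · simp [glue, hv]
    · simp [glue, hv, apply_eq_of_reflTransGen_legalMove h (v := v) (by simpa using hv)]
  rw [e1, e2] at main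
  have := pow_le_pow_left₀ (abs_nonneg _) main 2
  rw [sq_abs, mul_pow, Real.sq_sqrt hQ0] at this
  simpa using this

open Classical in
/-- The indicator that the block at `y` is good. -/
noncomputable def goodInd {ℓ : ℕ} (G : Set (Config (block d ℓ))) (y : Site d) (ω : Config (Site d)) : ℝ :=
  if restrictBlock ℓ y ω ∈ G then 1 else 0

open Classical in
/-- The indicator that the blocks of the *-oriented neighbourhood of `x` are good. -/
noncomputable def starInd {ℓ : ℕ} (G : Set (Config (block d ℓ))) (x : Site d) (ω : Config (Site d)) : ℝ :=
  if ∀ y ∈ starFinset x, restrictBlock ℓ y ω ∈ G then 1 else 0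

theorem starInd_mul_self {ℓ : ℕ} (G : Set (Config (block d ℓ))) (x : Site d) :
    starInd G x * starInd G x = starInd G x := by
  funext ω; simp [starInd]

theorem restrictBlock_congr {ℓ : ℕ} {y : Site d} {ω ω' : Config (Site d)}
    (h : ∀ v ∈ blockFinset ℓ y, ω v = ω' v) : restrictBlock ℓ y ω = restrictBlock ℓ y ω' :=
  funext fun z => h _ (mem_blockFinset.2 ⟨z.1, z.2, rfl⟩)

theorem dependsOn_starInd {ℓ : ℕ} (G : Set (Config (block d ℓ))) (x : Site d) :
    DependsOn (starInd G x) ((starFinset x).biUnion (blockFinset ℓ) : Set (Site d)) := by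
  intro ω ω' h
  have : ∀ y ∈ starFinset x, restrictBlock ℓ y ω = restrictBlock ℓ y ω' := fun y hy =>
    restrictBlock_congr fun v hv => h v (by
      simpa using ⟨y, hy, hv⟩)
  simp only [starInd]
  congr 1
  simp only [eq_iff_iff]
  exact forall₂_congr fun y hy => by rw [this y hy]

/-- Union bound over the at most 2^d neighbouring blocks. -/
theorem avg_one_sub_starInd_le {q : ℝ} (h0 : 0 ≤ q) (h1 : q ≤ 1) {ℓ : ℕ}
    {G : Set (Config (block d ℓ))} {ε : ℝ} (hε0 : 0 ≤ ε)
    (hG : ∀ y ω, 1 - ε ≤ avg q (blockFinset ℓ y) (goodInd G y) ω) (x : Site d)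
    (ω : Config (Site d)) :
    avg q ((starFinset x).biUnion (blockFinset ℓ)) (1 - starInd G x) ω ≤ 2 ^ d * ε := by
  set U := (starFinset x).biUnion (blockFinset ℓ) with hU
  have hle : 1 - starInd G x ≤ ∑ y ∈ starFinset x, (1 - goodInd G y) := by
    intro u
    have hterm : ∀ y ∈ starFinset x, 0 ≤ 1 - goodInd G y u := fun y _ => by
      simp only [goodInd]; split_ifs <;> norm_num
    simp only [Pi.sub_apply, Pi.one_apply, Finset.sum_apply]
    by_cases h : ∀ y ∈ starFinset x, restrictBlock ℓ y u ∈ G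
    · simpa [starInd, if_pos h] using Finset.sum_nonneg hterm
    · rw [starInd, if_neg h]
      push Not at h
      obtain ⟨y, hy, hyG⟩ := h
      refine le_trans (le_of_eq ?_) (Finset.single_le_sum hterm hy)
      simp [goodInd, hyG]
  have hblock : ∀ y ∈ starFinset x, avg q U (1 - goodInd G y) ω ≤ ε := by
    intro y hy
    rw [← avg_avg_of_subset q (Finset.subset_biUnion_of_mem (blockFinset ℓ) hy)]
    have : avg q (blockFinset ℓ y) (1 - goodInd G y) ≤ fun _ => ε := by
      intro u
      have := hG y u
      rw [map_sub, avg_one]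
      simp only [Pi.sub_apply, Pi.one_apply]
      linarith
    refine (avg_mono h0 h1 U this ω).trans_eq ?_
    rw [avg_of_freeOf (freeOf_const U ε)]
  refine (avg_mono h0 h1 U hle ω).trans ?_
  rw [map_sum, Finset.sum_apply]
  refine (Finset.sum_le_card_nsmul _ _ _ hblock).trans ?_
  rw [nsmul_eq_mul]
  refine mul_le_mul_of_nonneg_right ?_ hε0
  have : (starFinset x).card ≤ 2 ^ d := by
    rw [← card_insert_starFinset x]
    exact Finset.card_le_card (Finset.subset_insert _ _)
  exact_mod_cast this

/-- The constant in the comparison of a block with its single spins. -/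
noncomputable def windowConst (d ℓ : ℕ) (q : ℝ) : ℝ :=
  ((2 : ℝ) ^ (2 ^ d * ℓ ^ d)) ^ 2 *
    ((q * (1 - q))⁻¹ * ((q * (1 - q)) ^ (2 ^ d * ℓ ^ d))⁻¹)

theorem windowConst_nonneg (d ℓ : ℕ) {q : ℝ} (h0 : 0 < q) (h1 : q < 1) :
    0 ≤ windowConst d ℓ q := by
  have hq : 0 < 1 - q := by linarith
  unfold windowConst; positivity

/-- Replace the block mean by the value of F with the block emptied: it is free of the block, so
this only increases the square. On facilitated configurations the path to the emptied one bounds the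
difference. -/
theorem IsGood.avg_starInd_mul_le {p : unitInterval} {ℓ : ℕ} (hℓ : 0 < ℓ) {ε : ℝ}
    {G : Set (Config (block d ℓ))} (hG : K.IsGood p ℓ ε G) {q : ℝ} (h0 : 0 < q) (h1 : q < 1)
    {W : Finset (Site d)} {x : Site d} (hW : window ℓ x ⊆ W) (F : Config (Site d) → ℝ)
    (ω : Config (Site d)) :
    avg q W (starInd G x * (F - avg q (blockFinset ℓ x) F) ^ 2) ω ≤
      windowConst d ℓ q * ∑ v ∈ window ℓ x, avg q W (K.c v * spinVar q v F) ω := by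
  have hq : 0 < 1 - q := by linarith
  set B := blockFinset ℓ x with hB
  have hBwin : B ⊆ window ℓ x :=
    Finset.subset_biUnion_of_mem (blockFinset ℓ) (Finset.mem_insert_self _ _)
  have hBW : B ⊆ W := hBwin.trans hW
  set g := starInd G x with hg
  have hgB : FreeOf B g := by
    intro u u' h
    refine dependsOn_starInd G x fun v hv => h v ?_
    intro hvB
    simp only [Finset.coe_biUnion, Set.mem_iUnion, Finset.mem_coe] at hv hvB
    obtain ⟨y, hy, hvy⟩ := hv
    exact Finset.disjoint_left.1
      (blockFinset_pairwise_disjoint hℓ (mem_starFinset.1 hy).1) hvy hvB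
  set k : Config (Site d) → ℝ := fun u => F (setZeros B B u) with hk
  have hkB : FreeOf B k := fun u u' h => congrArg F (setZeros_congr fun v hv => h v (by simpa using hv))
  have hmul : ∀ a : Config (Site d) → ℝ, g * a ^ 2 = (g * a) ^ 2 := by
    intro a; rw [mul_pow, pow_two g, hg, starInd_mul_self]
  have e1 : g * (F - avg q B F) ^ 2 = (g * F - avg q B (g * F)) ^ 2 := by
    rw [hmul, avg_mul_of_freeOf hgB, mul_sub]
  have s1 : avg q W (g * (F - avg q B F) ^ 2) ω ≤ avg q W (g * (F - k) ^ 2) ω := by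
    rw [e1, hmul, mul_sub]
    exact fluct_le_avg_sq_sub h0.le h1.le hBW (g * F) (hgB.mul hkB) ω
  refine s1.trans ?_
  set H : Config (Site d) → ℝ := ∑ v ∈ window ℓ x, K.c v * spinVar q v F with hH
  have hH0 : 0 ≤ H := by
    intro u
    simp only [hH, Finset.sum_apply, Pi.mul_apply]
    exact Finset.sum_nonneg fun v _ =>
      mul_nonneg (K.c_nonneg v u) (spinVar_nonneg h0.le h1.le v F u)
  have hcard := card_window_le ℓ x
  have s2 : g * (F - k) ^ 2 ≤ windowConst d ℓ q • avg q (window ℓ x) H := by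
    intro u
    have hR : 0 ≤ avg q (window ℓ x) H u := avg_nonneg h0.le h1.le _ hH0 u
    simp only [Pi.mul_apply, Pi.pow_apply, Pi.sub_apply, Pi.smul_apply, smul_eq_mul]
    by_cases hu : ∀ y ∈ starFinset x, restrictBlock ℓ y u ∈ G
    · rw [hg, starInd, if_pos hu, one_mul]
      refine (sq_sub_le_of_reflTransGen_legalMove h0 h1 (hG.reflTransGen hℓ hu) F).trans ?_
      rw [windowConst, ← mul_assoc]
      refine mul_le_mul_of_nonneg_right ?_ hR
      refine mul_le_mul ?_ ?_ (by positivity) (by positivity)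
      · exact pow_le_pow_left₀ (by positivity) (pow_le_pow_right₀ (by norm_num) hcard) 2
      · refine mul_le_mul_of_nonneg_left ?_ (by positivity)
        refine inv_anti₀ (by positivity) ?_
        exact pow_le_pow_of_le_one (by positivity) (by nlinarith) hcard
    · rw [hg, starInd, if_neg hu, zero_mul]
      exact mul_nonneg (windowConst_nonneg d ℓ h0 h1) hR
  refine (avg_mono h0.le h1.le W s2 ω).trans_eq ?_
  rw [map_smul, avg_avg_of_subset q hW, hH, map_sum, Pi.smul_apply, Finset.sum_apply, smul_eq_mul]

theorem window_card_filter_le {ℓ : ℕ} (hℓ : 0 < ℓ) (L : Finset (Site d)) (v : Site d) :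
    (L.filter fun x => v ∈ window ℓ x).card ≤ 2 ^ d := by
  refine le_trans (Finset.card_le_card fun x hx => ?_)
    (card_filter_mem_insert_starFinset_le L fun i => v i / (ℓ : ℤ))
  rw [Finset.mem_filter] at hx ⊢
  obtain ⟨hxL, hx⟩ := hx
  obtain ⟨y, hy, hv⟩ := Finset.mem_biUnion.1 hx
  rw [mem_blockFinset_iff_ediv hℓ] at hv
  rw [← funext hv] at hy
  exact ⟨hxL, hy⟩

/-- The block inequality and the path comparison combine; the last factor 2^d counts the windows
containing a given site. -/
theorem IsGood.fluct_le_of_dependsOn {p : unitInterval} {ℓ : ℕ} (hℓ : 0 < ℓ) {ε : ℝ}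
    {G : Set (Config (block d ℓ))} (hG : K.IsGood p ℓ ε G) {q : ℝ} (h0 : 0 < q) (h1 : q < 1)
    (hε0 : 0 ≤ ε) (hε : 4 * (2 ^ d * ε) * 2 ^ d ≤ 1)
    (hGq : ∀ y ω, 1 - ε ≤ avg q (blockFinset ℓ y) (goodInd G y) ω)
    {A : Finset (Site d)} {F : Config (Site d) → ℝ} (hF : DependsOn F (A : Set (Site d))) :
    ∃ W : Finset (Site d), A ⊆ W ∧ ∀ ω, fluct q W W F ω ≤
      4 * windowConst d ℓ q * 2 ^ d * ∑ v ∈ W, avg q W (K.c v * spinVar q v F) ω := by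
  set b : Site d → Finset (Site d) := blockFinset ℓ with hb
  set L : Finset (Site d) := A.image fun v i => v i / (ℓ : ℤ) with hL
  set M : Finset (Site d) := L.biUnion fun x => insert x (starFinset x) with hM
  have hins : ∀ x ∈ L, insert x (starFinset x) ⊆ M := fun x hx =>
    Finset.subset_biUnion_of_mem (fun x => insert x (starFinset x)) hx
  have hLM : L ⊆ M := fun x hx => hins x hx (Finset.mem_insert_self _ _)
  have hAL : ∀ v ∈ A, ∀ x, v ∈ b x → x ∈ L := by
    intro v hv x hx
    rw [hb, mem_blockFinset_iff_ediv hℓ] at hx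
    exact Finset.mem_image.2 ⟨v, hv, funext hx⟩
  refine ⟨M.biUnion b, fun v hv => ?_, fun ω => ?_⟩
  · have : v ∈ b fun i => v i / (ℓ : ℤ) := (mem_blockFinset_iff_ediv hℓ).2 fun _ => rfl
    exact Finset.mem_biUnion.2 ⟨_, hLM (hAL v hv _ this), this⟩
  · have hwin : ∀ x ∈ L, window ℓ x ⊆ M.biUnion b := fun x hx =>
      Finset.biUnion_subset_biUnion_of_subset_left b (hins x hx)
    -- The instance is passed by hand: the total order needed is the lexicographic one, for which
    -- *-oriented neighbours of x are larger than x.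
    have main := @fluct_le_four_mul_sum_constrained (Site d) _ q h0.le h1.le (Site d)
      (LinearOrder.lift' (toLex : Site d → Lex (Site d)) toLex.injective) _ b
      (blockFinset_pairwise_disjoint hℓ) starFinset
      (fun x z hz => by
        have hz := mem_starFinset.1 hz
        refine Pi.toLex_strictMono (lt_of_le_of_ne (fun i => ?_) hz.1.symm)
        change x i ≤ z i
        rcases hz.2 i with h | h <;> rw [h]
        exact (lt_add_one _).le)
      (starInd G) (starInd_mul_self G) (dependsOn_starInd G) (2 ^ d * ε)
      (avg_one_sub_starInd_le h0.le h1.le hε0 hGq) (by positivity) L M hLM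
      (fun x hx => (Finset.subset_insert _ _).trans (hins x hx)) (2 ^ d)
      (card_filter_mem_insert_starFinset_le L) (by exact_mod_cast hε) F
      (fun x _ hxL u u' h => hF fun v hv => h v fun hvx => hxL (hAL v hv x hvx)) ω
    refine main.trans ?_
    rw [mul_assoc, mul_assoc]
    refine mul_le_mul_of_nonneg_left ?_ (by norm_num)
    refine (Finset.sum_le_sum fun x hx =>
      hG.avg_starInd_mul_le hℓ h0 h1 (hwin x hx) F ω).trans ?_
    rw [← Finset.mul_sum]
    refine mul_le_mul_of_nonneg_left ?_ (windowConst_nonneg d ℓ h0 h1)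
    have := sum_sum_le_mul_sum (s := window ℓ) hwin
      (a := fun v => avg q (M.biUnion b) (K.c v * spinVar q v F) ω)
      (fun v => avg_nonneg h0.le h1.le _ (fun u =>
        mul_nonneg (K.c_nonneg v u) (spinVar_nonneg h0.le h1.le v F u)) ω)
      (N := 2 ^ d) fun v _ => window_card_filter_le hℓ L v
    exact_mod_cast this

end KCSM

/-! ### Resampling one spin -/

section Resample

variable {V : Type} [DecidableEq V]

theorem preimage_update_pi {s : Finset V} {t : V → Set (Fin 2)} {x : V} {a : Fin 2} :
    (fun ω : Config V => Function.update ω x a) ⁻¹' (s : Set V).pi t =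
      {ω | (x ∈ s → a ∈ t x) ∧ ω ∈ ((s.erase x : Finset V) : Set V).pi t} := by
  ext ω
  simp only [Set.mem_preimage, Set.mem_pi, Finset.mem_coe, Set.mem_ofPred_eq, Finset.mem_erase]
  constructor
  · intro h
    refine ⟨fun hx => by simpa using h x hx, fun i hi => ?_⟩
    simpa [Function.update_of_ne hi.1] using h i hi.2
  · rintro ⟨h1, h2⟩ i hi
    by_cases hix : i = x
    · subst hix; simpa using h1 hi
    · rw [Function.update_of_ne hix]; exact h2 i ⟨hix, hi⟩

theorem toNNReal_add_toNNReal_symm (p : unitInterval) :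
    (unitInterval.toNNReal p : ℝ≥0∞) + (unitInterval.toNNReal (unitInterval.symm p) : ℝ≥0∞) = 1 := by
  rw [← ENNReal.coe_add, ← ENNReal.coe_one, ENNReal.coe_inj]
  ext
  simp

/-- Invariance of the product law under resampling one spin, checked on finite cylinders, which
determine the measure. -/
theorem productLaw_eq_resample (p : unitInterval) (x : V) :
    unitInterval.toNNReal p • (productLaw V p).map (fun ω => Function.update ω x 0) +
      unitInterval.toNNReal (unitInterval.symm p) •
        (productLaw V p).map (fun ω => Function.update ω x 1) = productLaw V p := by
  classical
  refine Measure.eq_infinitePi _ fun s t ht => ?_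
  have hm : ∀ a : Fin 2, (productLaw V p).map (fun ω => Function.update ω x a) ((s : Set V).pi t) =
      if x ∈ s → a ∈ t x then ∏ i ∈ s.erase x, siteLaw p (t i) else 0 := by
    intro a
    rw [Measure.map_apply measurable_update_left
      (MeasurableSet.pi s.countable_toSet fun i _ => ht i), preimage_update_pi]
    split_ifs with h
    · exact (congrArg _ (Set.ext fun ω => and_iff_right h)).trans
        (Measure.infinitePi_pi _ fun i _ => ht i)
    · simp [h]
  rw [Measure.add_apply, Measure.smul_apply, Measure.smul_apply, hm, hm]
  simp only [ENNReal.smul_def, smul_eq_mul]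
  by_cases hx : x ∈ s
  · rw [← Finset.mul_prod_erase s _ hx]
    simp only [hx, true_implies, bernoulliMeasure_def, Measure.add_apply, Measure.smul_apply,
      Measure.dirac_apply' _ (ht x), ENNReal.smul_def, smul_eq_mul]
    by_cases h0 : (0 : Fin 2) ∈ t x <;> by_cases h1 : (1 : Fin 2) ∈ t x <;>
      simp [h0, h1, add_mul]
  · simp only [hx, false_implies, if_true, Finset.erase_eq_of_notMem hx]
    rw [← add_mul, toNNReal_add_toNNReal_symm, one_mul]

theorem lintegral_productLaw_resample (p : unitInterval) (x : V) {h : Config V → ℝ≥0∞}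
    (hh : Measurable h) :
    ∫⁻ ω, h ω ∂(productLaw V p) =
      unitInterval.toNNReal p * ∫⁻ ω, h (Function.update ω x 0) ∂(productLaw V p) +
      unitInterval.toNNReal (unitInterval.symm p) *
        ∫⁻ ω, h (Function.update ω x 1) ∂(productLaw V p) := by
  conv_lhs => rw [← productLaw_eq_resample p x]
  rw [lintegral_add_measure, lintegral_smul_measure, lintegral_smul_measure,
    lintegral_map hh measurable_update_left, lintegral_map hh measurable_update_left]
  rfl

/-- Both weights in the resampling identity are positive, so a null set is null for each of the two
image measures. -/
theorem ae_update_of_ae {p : unitInterval} (hp0 : 0 < p) (hp1 : p < 1) (x : V)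
    {P : Config V → Prop} (h : ∀ᵐ ω ∂(productLaw V p), P ω) (s : Fin 2) :
    ∀ᵐ ω ∂(productLaw V p), P (Function.update ω x s) := by
  rw [← productLaw_eq_resample p x, ae_add_measure_iff] at h
  have hq0 : unitInterval.toNNReal p ≠ 0 := by
    intro h; have := congrArg NNReal.toReal h; simp at this; exact hp0.ne' this
  have hq1 : unitInterval.toNNReal (unitInterval.symm p) ≠ 0 := by
    intro h
    have := congrArg NNReal.toReal h
    have hp : (p : ℝ) < 1 := hp1
    simp at this
    linarith
  obtain ⟨h0, h1⟩ := h
  rw [Measure.ae_smul_measure_iff hq0] at h0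
  rw [Measure.ae_smul_measure_iff hq1] at h1
  have two : ∀ t : Fin 2, t = 0 ∨ t = 1 := by decide
  rcases two s with rfl | rfl
  · exact ae_of_ae_map measurable_update_left.aemeasurable h0
  · exact ae_of_ae_map measurable_update_left.aemeasurable h1

end Resample

/-! ### Local functions and their integrals -/

section Local

set_option linter.unusedSectionVars false

variable {V : Type} [DecidableEq V]

theorem DependsOn.exists_comp_restrict {A : Finset V} {h : Config V → ℝ}
    (hh : DependsOn h (A : Set V)) : ∃ g : Config A → ℝ, h = fun ω => g fun v => ω v := by
  refine ⟨fun σ => h fun v => if hv : v ∈ A then σ ⟨v, hv⟩ else 0, ?_⟩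
  funext ω
  exact hh fun v hv => by
    have : v ∈ A := hv
    simp [this]

theorem DependsOn.measurable {A : Finset V} {h : Config V → ℝ} (hh : DependsOn h (A : Set V)) :
    Measurable h := by
  obtain ⟨g, rfl⟩ := hh.exists_comp_restrict
  have hg : Measurable g := measurable_of_finite g
  fun_prop

theorem DependsOn.memLp {A : Finset V} {h : Config V → ℝ} (hh : DependsOn h (A : Set V))
    (r : ℝ≥0∞) (p : unitInterval) : MemLp h r (productLaw V p) := by
  have hm := hh.measurable
  obtain ⟨g, rfl⟩ := hh.exists_comp_restrict
  obtain ⟨C, hC⟩ := Finite.exists_le fun σ => ‖g σ‖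
  exact MemLp.of_bound hm.aestronglyMeasurable C (ae_of_all _ fun ω => hC _)

theorem DependsOn.integrable {A : Finset V} {h : Config V → ℝ} (hh : DependsOn h (A : Set V))
    (p : unitInterval) : Integrable h (productLaw V p) :=
  memLp_one_iff_integrable.1 (hh.memLp 1 p)

theorem DependsOn.avg {S : Set V} {h : Config V → ℝ} (hh : DependsOn h S) (q : ℝ)
    (B : Finset V) : DependsOn (avg q B h) S := by
  intro x y H
  simp only [avg_apply]
  refine Finset.sum_congr rfl fun T _ => ?_
  congr 1
  refine hh fun v hv => ?_
  by_cases hB : v ∈ B <;> simp [_root_.setZeros, hB, H v hv]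

theorem DependsOn.mul {S : Set V} {g h : Config V → ℝ} (hg : DependsOn g S)
    (hh : DependsOn h S) : DependsOn (g * h) S := fun x y H => by
  simp only [Pi.mul_apply]; rw [hg H, hh H]

theorem DependsOn.sub {S : Set V} {g h : Config V → ℝ} (hg : DependsOn g S)
    (hh : DependsOn h S) : DependsOn (g - h) S := fun x y H => by
  simp only [Pi.sub_apply]; rw [hg H, hh H]

theorem DependsOn.pow {S : Set V} {g : Config V → ℝ} (hg : DependsOn g S) (n : ℕ) :
    DependsOn (g ^ n) S := fun x y H => by
  simp only [Pi.pow_apply]; rw [hg H]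

theorem DependsOn.comp_update {S : Set V} {h : Config V → ℝ} (hh : DependsOn h S) (x : V)
    (s : Fin 2) : DependsOn (fun ω => h (Function.update ω x s)) S := fun u v H => hh fun i hi => by
  by_cases hix : i = x
  · subst hix; simp
  · simp [Function.update_of_ne hix, H i hi]

theorem DependsOn.spinVar {S : Set V} {h : Config V → ℝ} (hh : DependsOn h S) (q : ℝ) (x : V) :
    DependsOn (spinVar q x h) S := fun u v H => by
  simp only [_root_.spinVar]
  have h0 := hh.comp_update x 0 H
  have h1 := hh.comp_update x 1 H
  simp only at h0 h1
  rw [h0, h1]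

theorem integral_avg {A : Finset V} {h : Config V → ℝ} (hh : DependsOn h (A : Set V))
    (p : unitInterval) (B : Finset V) :
    ∫ ω, avg (p : ℝ) B h ω ∂(productLaw V p) = ∫ ω, h ω ∂(productLaw V p) := by
  induction B using Finset.induction_on with
  | empty => rw [avg_empty]
  | insert x B hx ih =>
    rw [avg_insert _ hx, ← ih]
    set g := avg (p : ℝ) B h with hg
    have hgA : DependsOn g (A : Set V) := hh.avg _ B
    have hi : ∀ a : Fin 2, Integrable g ((productLaw V p).map fun ω => Function.update ω x a) :=
      fun a => (integrable_map_measure hgA.measurable.aestronglyMeasurable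
        measurable_update_left.aemeasurable).2 ((hgA.comp_update x a).integrable p)
    have e : ∀ a : Fin 2, ∫ ω, g ω ∂((productLaw V p).map fun ω => Function.update ω x a) =
        ∫ ω, g (Function.update ω x a) ∂(productLaw V p) := fun a =>
      integral_map measurable_update_left.aemeasurable hgA.measurable.aestronglyMeasurable
    conv_rhs => rw [← productLaw_eq_resample p x]
    rw [integral_add_measure ((hi 0).smul_measure_nnreal) ((hi 1).smul_measure_nnreal),
      integral_smul_nnreal_measure, integral_smul_nnreal_measure, e, e]
    simp only [avg_singleton]
    rw [integral_add (((hgA.comp_update x 0).integrable p).const_mul _)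
      (((hgA.comp_update x 1).integrable p).const_mul _), integral_const_mul, integral_const_mul]
    simp [NNReal.smul_def]

/-- Once every relevant spin is averaged the result is constant, hence equal to its own integral. -/
theorem avg_eq_integral {A B : Finset V} {h : Config V → ℝ} (hh : DependsOn h (A : Set V))
    (hAB : A ⊆ B) (p : unitInterval) (ω : Config V) :
    avg (p : ℝ) B h ω = ∫ ω, h ω ∂(productLaw V p) := by
  have hconst : ∀ ω', avg (p : ℝ) B h ω' = avg (p : ℝ) B h ω := by
    intro ω'
    simp only [avg_apply]
    refine Finset.sum_congr rfl fun T _ => ?_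
    congr 1
    refine hh fun v hv => ?_
    have : v ∈ B := hAB hv
    simp [setZeros, this]
  rw [← integral_avg hh p B]
  simp [hconst]

end Local

/-- Transfers the probability bound on G from Λ₀ to every translated block. -/
theorem map_restrictBlock {d : ℕ} (ℓ : ℕ) (y : Site d) (p : unitInterval) :
    (productLaw (Site d) p).map (restrictBlock ℓ y) = productLaw (block d ℓ) p := by
  have hmeas : Measurable (restrictBlock (d := d) ℓ y) := by
    unfold restrictBlock; fun_prop
  refine Measure.eq_infinitePi _ fun s t ht => ?_
  rw [Measure.map_apply hmeas (MeasurableSet.pi s.countable_toSet fun i _ => ht i)]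
  set φ : block d ℓ ↪ Site d :=
    (Function.Embedding.subtype _).trans (addRightEmbedding ((ℓ : ℤ) • y)) with hφ
  have hφa : ∀ z, φ z = z.1 + (ℓ : ℤ) • y := fun z => rfl
  have e : restrictBlock ℓ y ⁻¹' (s : Set (block d ℓ)).pi t =
      ((s.map φ : Finset (Site d)) : Set (Site d)).pi
        (fun v => if h : ∃ z, φ z = v then t h.choose else Set.univ) := by
    ext ω
    simp only [Set.mem_preimage, Set.mem_pi, Finset.coe_map, Set.forall_mem_image]
    refine forall₂_congr fun z _ => ?_
    have hz : ∃ w, φ w = φ z := ⟨z, rfl⟩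
    rw [dif_pos hz, φ.injective hz.choose_spec]
    rfl
  rw [e, Measure.infinitePi_pi _ fun v _ => ?_, Finset.prod_map]
  · refine Finset.prod_congr rfl fun z _ => ?_
    have hz : ∃ w, φ w = φ z := ⟨z, rfl⟩
    rw [dif_pos hz, φ.injective hz.choose_spec]
  · split_ifs
    · exact ht _
    · exact .univ

/-! ### From local functions to the domain of the generator -/

theorem localVar_eq_spinVar {d : ℕ} (p : unitInterval) (x : Site d) (f : Config (Site d) → ℝ)
    (ω : Config (Site d)) : localVar p x f ω = spinVar (p : ℝ) x f ω := by
  simp only [localVar, integral_bernoulliMeasure, spinVar, smul_eq_mul]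
  ring

theorem spinVar_eq_avg {V : Type} [DecidableEq V] (q : ℝ) (x : V) (f : Config V → ℝ) :
    spinVar q x f = avg q {x} (f ^ 2) - avg q {x} f ^ 2 := by
  funext ω
  simp only [Pi.sub_apply, Pi.pow_apply, avg_singleton, spinVar]
  ring

theorem spinVar_add_le {V : Type} {q : ℝ} [DecidableEq V] (h0 : 0 ≤ q) (h1 : q ≤ 1) (x : V)
    (f g : Config V → ℝ) (ω : Config V) :
    spinVar q x (f + g) ω ≤ 2 * spinVar q x f ω + 2 * spinVar q x g ω := by
  have : 0 ≤ q * (1 - q) := mul_nonneg h0 (by linarith)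
  simp only [spinVar, Pi.add_apply]
  set a := f (Function.update ω x 0) - f (Function.update ω x 1)
  set b := g (Function.update ω x 0) - g (Function.update ω x 1)
  have e : f (Function.update ω x 0) + g (Function.update ω x 0) -
      (f (Function.update ω x 1) + g (Function.update ω x 1)) = a + b := by ring
  rw [e]
  nlinarith [mul_nonneg this (sq_nonneg (a - b))]

theorem variance_le_two_mul_add {Ω : Type*} [MeasurableSpace Ω] {μ : Measure Ω}
    [IsProbabilityMeasure μ] {f g : Ω → ℝ} (hf : MemLp f 2 μ) (hg : MemLp g 2 μ) :
    Var[f; μ] ≤ 2 * Var[g; μ] + 2 * ∫ ω, (g ω - f ω) ^ 2 ∂μ := by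
  have hgm : MemLp (fun ω => g ω - ∫ ω, g ω ∂μ) 2 μ := hg.sub (memLp_const _)
  have hfm : MemLp (fun ω => f ω - ∫ ω, g ω ∂μ) 2 μ := hf.sub (memLp_const _)
  have hgf : MemLp (fun ω => g ω - f ω) 2 μ := hg.sub hf
  have h1 := variance_le_expectation_sq hfm.aestronglyMeasurable
  rw [variance_sub_const hf.aestronglyMeasurable] at h1
  rw [variance_eq_integral hg.aemeasurable, ← integral_const_mul, ← integral_const_mul,
    ← integral_add (hgm.integrable_sq.const_mul _) (hgf.integrable_sq.const_mul _)]
  refine h1.trans (integral_mono hfm.integrable_sq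
    ((hgm.integrable_sq.const_mul _).add (hgf.integrable_sq.const_mul _)) fun ω => ?_)
  simp only [Pi.pow_apply]
  nlinarith [sq_nonneg (f ω - ∫ ω, g ω ∂μ + (g ω - f ω) + (g ω - f ω))]

theorem lintegral_ofReal_sq {Ω : Type*} [MeasurableSpace Ω] (μ : Measure Ω) (f : Ω → ℝ) :
    ∫⁻ ω, ENNReal.ofReal (f ω ^ 2) ∂μ = eLpNorm f 2 μ ^ 2 := by
  have := eLpNorm_nnreal_pow_eq_lintegral (μ := μ) (f := f) (p := 2) two_ne_zero
  simp only [NNReal.coe_ofNat, ENNReal.coe_ofNat] at this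
  norm_cast at this
  rw [this]
  refine lintegral_congr fun ω => ?_
  rw [← enorm_pow, Real.enorm_of_nonneg (sq_nonneg _)]

/-! ### Single-site energies and integration by parts -/

namespace KCSM

variable {d : ℕ} {K : KCSM d}

theorem c_congr {x : Site d} {ω ω' : Config (Site d)}
    (h : K.Constraint x ω ↔ K.Constraint x ω') : K.c x ω = K.c x ω' := by
  by_cases hω : K.Constraint x ω
  · rw [c_of_constraint hω, c_of_constraint (h.1 hω)]
  · rw [c, c, if_neg hω, if_neg fun h' => hω (h.2 h')]

theorem exists_dependsOn_c (K : KCSM d) (x : Site d) :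
    ∃ A : Finset (Site d), DependsOn (K.c x) (A : Set (Site d)) := by
  refine ⟨Fintype.piFinset fun i => Finset.Icc (x i - K.range) (x i + K.range), ?_⟩
  have key : ∀ ω ω' : Config (Site d), (∀ v ∈ Fintype.piFinset fun i =>
      Finset.Icc (x i - (K.range : ℤ)) (x i + K.range), ω v = ω' v) →
      K.Constraint x ω → K.Constraint x ω' := by
    rintro ω ω' h ⟨A, hA, h'⟩
    refine ⟨A, hA, fun y hy => ?_⟩
    rw [← h y, h' y hy]
    rw [Fintype.mem_piFinset]
    intro i
    have h1 := (K.finite_range x A hA y hy).2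
    have h2 : |y i - x i| ≤ l1Dist x y :=
      Finset.single_le_sum (f := fun i => |y i - x i|) (fun _ _ => abs_nonneg _)
        (Finset.mem_univ i)
    have := abs_le.1 (h2.trans h1)
    rw [Finset.mem_Icc]
    constructor <;> linarith
  intro ω ω' h
  exact c_congr ⟨key ω ω' fun v hv => h v hv, key ω' ω fun v hv => (h v hv).symm⟩

theorem freeOf_c (K : KCSM d) (x : Site d) : FreeOf {x} (K.c x) := by
  intro ω ω' h
  have e : ω' = Function.update ω x (ω' x) := by
    funext v
    by_cases hv : v = x
    · subst hv; simp
    · rw [Function.update_of_ne hv]; exact (h v (by simpa using hv)).symm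
  have e' : ω = Function.update ω' x (ω x) := by
    rw [e]; simp
  exact c_congr ⟨fun h => e ▸ h.update _, fun h => e' ▸ h.update _⟩

/-- The contribution of the site `x` to the Dirichlet form. -/
noncomputable def siteEnergy (K : KCSM d) (p : unitInterval) (x : Site d) (f : Config (Site d) → ℝ) :
    ℝ≥0∞ :=
  ∫⁻ ω, ENNReal.ofReal (K.c x ω * localVar p x f ω) ∂(productLaw (Site d) p)

theorem measurable_c (K : KCSM d) (x : Site d) : Measurable (K.c x) := by
  obtain ⟨A, hA⟩ := K.exists_dependsOn_c x
  exact hA.measurable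

theorem siteEnergy_eq (p : unitInterval) (x : Site d) (f : Config (Site d) → ℝ) :
    K.siteEnergy p x f =
      ∫⁻ ω, ENNReal.ofReal (K.c x ω * spinVar (p : ℝ) x f ω) ∂(productLaw (Site d) p) := by
  simp only [siteEnergy, localVar_eq_spinVar]

theorem measurable_ofReal_c_mul_spinVar (p : unitInterval) (x : Site d) {f : Config (Site d) → ℝ}
    (hf : Measurable f) :
    Measurable fun ω => ENNReal.ofReal (K.c x ω * spinVar (p : ℝ) x f ω) := by
  have h0 : ∀ s : Fin 2, Measurable fun ω : Config (Site d) => f (Function.update ω x s) :=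
    fun s => hf.comp measurable_update_left
  have := K.measurable_c x
  unfold spinVar
  exact (this.mul ((((h0 0).sub (h0 1)).pow_const 2).const_mul _)).ennreal_ofReal

theorem siteEnergy_add_le (p : unitInterval) (x : Site d) {f : Config (Site d) → ℝ}
    (hf : Measurable f) (g : Config (Site d) → ℝ) :
    K.siteEnergy p x (f + g) ≤ 2 * K.siteEnergy p x f + 2 * K.siteEnergy p x g := by
  simp only [siteEnergy_eq]
  rw [← lintegral_const_mul' _ _ (by simp), ← lintegral_const_mul' _ _ (by simp),
    ← lintegral_add_left ((measurable_ofReal_c_mul_spinVar p x hf).const_mul _)]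
  refine lintegral_mono fun ω => ?_
  have hc := K.c_nonneg x ω
  have hf0 := spinVar_nonneg p.2.1 p.2.2 x f ω
  have hg0 := spinVar_nonneg p.2.1 p.2.2 x g ω
  have h2 : (2 : ℝ≥0∞) = ENNReal.ofReal 2 := by simp
  rw [h2, ← ENNReal.ofReal_mul (by norm_num), ← ENNReal.ofReal_mul (by norm_num),
    ← ENNReal.ofReal_add (by positivity) (by positivity)]
  refine ENNReal.ofReal_le_ofReal ?_
  have := mul_le_mul_of_nonneg_left (spinVar_add_le p.2.1 p.2.2 x f g ω) hc
  linarith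

/-- The constraint is at most 1 and a variance at most a second moment; resampling the spin then
gives the norm. Hence finitely many site energies are continuous in L². -/
theorem siteEnergy_le (p : unitInterval) (x : Site d) {f : Config (Site d) → ℝ}
    (hf : Measurable f) :
    K.siteEnergy p x f ≤ eLpNorm f 2 (productLaw (Site d) p) ^ 2 := by
  rw [← lintegral_ofReal_sq, siteEnergy_eq,
    lintegral_productLaw_resample p x (h := fun ω => ENNReal.ofReal (f ω ^ 2)) (by fun_prop),
    ← lintegral_const_mul' _ _ (by simp), ← lintegral_const_mul' _ _ (by simp),
    ← lintegral_add_left]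
  · refine lintegral_mono fun ω => ?_
    have e0 : (unitInterval.toNNReal p : ℝ≥0∞) = ENNReal.ofReal (p : ℝ) := by
      rw [ENNReal.ofReal]; congr 1; ext; simp [p.2.1]
    have e1 : (unitInterval.toNNReal (unitInterval.symm p) : ℝ≥0∞) =
        ENNReal.ofReal (1 - (p : ℝ)) := by
      rw [ENNReal.ofReal]; congr 1; ext; simp [p.2.2]
    have hp0 := p.2.1
    have hp1 : 0 ≤ 1 - (p : ℝ) := by linarith [p.2.2]
    rw [e0, e1, ← ENNReal.ofReal_mul hp0, ← ENNReal.ofReal_mul hp1,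
      ← ENNReal.ofReal_add (by positivity) (by positivity)]
    refine ENNReal.ofReal_le_ofReal ?_
    refine (mul_le_of_le_one_left (spinVar_nonneg p.2.1 p.2.2 x f ω) (K.c_le_one x ω)).trans ?_
    rw [spinVar]
    nlinarith [sq_nonneg ((p : ℝ) * f (Function.update ω x 0) +
      (1 - (p : ℝ)) * f (Function.update ω x 1))]
  · have h0 : Measurable fun ω : Config (Site d) => f (Function.update ω x 0) :=
      hf.comp measurable_update_left
    exact ((h0.pow_const 2).ennreal_ofReal).const_mul _

theorem exists_dependsOn_c_mul_spinVar {A : Finset (Site d)} {F : Config (Site d) → ℝ}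
    (hF : DependsOn F (A : Set (Site d))) (q : ℝ) (x : Site d) :
    ∃ B : Finset (Site d), DependsOn (K.c x * spinVar q x F) (B : Set (Site d)) := by
  obtain ⟨C, hC⟩ := K.exists_dependsOn_c x
  exact ⟨C ∪ A, (hC.mono (by simp)).mul ((hF.spinVar q x).mono (by simp))⟩

theorem siteEnergy_of_dependsOn {A : Finset (Site d)} {F : Config (Site d) → ℝ}
    (hF : DependsOn F (A : Set (Site d))) (p : unitInterval) (x : Site d) :
    K.siteEnergy p x F = ENNReal.ofReal
      (∫ ω, (K.c x * spinVar (p : ℝ) x F) ω ∂(productLaw (Site d) p)) := by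
  obtain ⟨B, hB⟩ := exists_dependsOn_c_mul_spinVar (K := K) hF (p : ℝ) x
  rw [ofReal_integral_eq_lintegral_ofReal (hB.integrable p) (ae_of_all _ fun ω =>
    mul_nonneg (K.c_nonneg x ω) (spinVar_nonneg p.2.1 p.2.2 x F ω)), siteEnergy_eq]
  rfl

theorem localGenerator_eq_sum {A : Finset (Site d)} {F : Config (Site d) → ℝ}
    (hF : DependsOn F (A : Set (Site d))) (p : unitInterval) :
    K.localGenerator p F = ∑ x ∈ A, K.c x * (avg (p : ℝ) {x} F - F) := by
  funext ω
  rw [localGenerator, Finset.sum_apply, tsum_eq_sum (s := A)]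
  · refine Finset.sum_congr rfl fun x _ => ?_
    simp [avg_singleton, integral_bernoulliMeasure]
  · intro x hx
    have : ∀ s, F (Function.update ω x s) = F ω := fun s => hF fun v hv => by
      rw [Function.update_of_ne]; rintro rfl; exact hx hv
    simp [this]

theorem localGenerator_sub {A : Finset (Site d)} {F F' : Config (Site d) → ℝ}
    (hF : DependsOn F (A : Set (Site d))) (hF' : DependsOn F' (A : Set (Site d)))
    (p : unitInterval) :
    K.localGenerator p (F - F') = K.localGenerator p F - K.localGenerator p F' := by
  rw [localGenerator_eq_sum hF, localGenerator_eq_sum hF', localGenerator_eq_sum (hF.sub hF'),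
    ← Finset.sum_sub_distrib]
  refine Finset.sum_congr rfl fun x _ => ?_
  rw [map_sub]; ring

theorem exists_dependsOn_localGenerator {A : Finset (Site d)} {F : Config (Site d) → ℝ}
    (hF : DependsOn F (A : Set (Site d))) (p : unitInterval) :
    ∃ B : Finset (Site d), DependsOn (K.localGenerator p F) (B : Set (Site d)) := by
  choose C hC using K.exists_dependsOn_c
  refine ⟨A.biUnion C ∪ A, fun ω ω' h => ?_⟩
  rw [localGenerator_eq_sum hF, Finset.sum_apply, Finset.sum_apply]
  refine Finset.sum_congr rfl fun x hx => ?_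
  have hFA : DependsOn F ((A.biUnion C ∪ A : Finset (Site d)) : Set (Site d)) := hF.mono (by simp)
  have hCx : C x ⊆ A.biUnion C ∪ A :=
    (Finset.subset_biUnion_of_mem C hx).trans Finset.subset_union_left
  exact ((hC x).mono (by exact_mod_cast hCx)).mul ((hFA.avg _ _).sub hFA) h

/-- Reversibility at one site: c_x is free of x, so averaging over the spin at x turns F(F - ν_x F)
into Var_x F. -/
theorem integral_c_mul_spinVar {A : Finset (Site d)} {F : Config (Site d) → ℝ}
    (hF : DependsOn F (A : Set (Site d))) (p : unitInterval) (x : Site d) :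
    ∫ ω, (K.c x * spinVar (p : ℝ) x F) ω ∂(productLaw (Site d) p) =
      -∫ ω, (F * (K.c x * (avg (p : ℝ) {x} F - F))) ω ∂(productLaw (Site d) p) := by
  obtain ⟨C, hC⟩ := K.exists_dependsOn_c x
  have hC' : DependsOn (K.c x) ((C ∪ A : Finset (Site d)) : Set (Site d)) := hC.mono (by simp)
  have hF' : DependsOn F ((C ∪ A : Finset (Site d)) : Set (Site d)) := hF.mono (by simp)
  rw [← integral_neg, ← integral_avg (hC'.mul (hF'.spinVar (p : ℝ) x)) p {x}]
  have h2 : DependsOn (K.c x * (F * (F - avg (p : ℝ) {x} F)))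
      ((C ∪ A : Finset (Site d)) : Set (Site d)) := hC'.mul (hF'.mul (hF'.sub (hF'.avg _ _)))
  have e : ∀ ω, -(F * (K.c x * (avg (p : ℝ) {x} F - F))) ω =
      (K.c x * (F * (F - avg (p : ℝ) {x} F))) ω := fun ω => by
    simp only [Pi.mul_apply, Pi.sub_apply]; ring
  simp only [e]
  rw [← integral_avg h2 p {x}]
  congr 2
  have hfree : FreeOf {x} (avg (p : ℝ) {x} F) := freeOf_avg _ _ _
  rw [avg_mul_of_freeOf (K.freeOf_c x), avg_mul_of_freeOf (K.freeOf_c x), spinVar_eq_avg,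
    avg_of_freeOf ((freeOf_avg _ _ _).sub (by rw [pow_two]; exact hfree.mul hfree)),
    mul_sub F, map_sub, avg_mul_of_freeOf_right hfree, pow_two, pow_two]

/-- Summing the integration by parts gives D(F) = -⟨F, LF⟩, and Hölder concludes. The bound does not
depend on S. -/
theorem sum_siteEnergy_le {A : Finset (Site d)} {F : Config (Site d) → ℝ}
    (hF : DependsOn F (A : Set (Site d))) (p : unitInterval) (S : Finset (Site d)) :
    ∑ x ∈ S, K.siteEnergy p x F ≤ eLpNorm F 2 (productLaw (Site d) p) *
      eLpNorm (K.localGenerator p F) 2 (productLaw (Site d) p) := by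
  set μ := productLaw (Site d) p with hμ
  refine (Finset.sum_le_sum_of_subset (Finset.subset_union_left (s₂ := A))).trans ?_
  have hF' : DependsOn F ((S ∪ A : Finset (Site d)) : Set (Site d)) := hF.mono (by simp)
  obtain ⟨B, hB⟩ := exists_dependsOn_localGenerator (K := K) hF p
  simp only [siteEnergy_of_dependsOn hF']
  have hnonneg : ∀ x ∈ S ∪ A, 0 ≤ ∫ ω, (K.c x * spinVar (p : ℝ) x F) ω ∂μ := fun x _ =>
    integral_nonneg fun ω => mul_nonneg (K.c_nonneg x ω) (spinVar_nonneg p.2.1 p.2.2 x F ω)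
  rw [← ENNReal.ofReal_sum_of_nonneg hnonneg]
  have hint : ∀ x, Integrable (F * (K.c x * (avg (p : ℝ) {x} F - F))) μ := by
    intro x
    obtain ⟨C, hC⟩ := K.exists_dependsOn_c x
    have hC' : DependsOn (K.c x) ((C ∪ A : Finset (Site d)) : Set (Site d)) := hC.mono (by simp)
    have hF' : DependsOn F ((C ∪ A : Finset (Site d)) : Set (Site d)) := hF.mono (by simp)
    exact (hF'.mul (hC'.mul ((hF'.avg _ _).sub hF'))).integrable p
  have e : ∑ x ∈ S ∪ A, ∫ ω, (K.c x * spinVar (p : ℝ) x F) ω ∂μ =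
      -∫ ω, (F * K.localGenerator p F) ω ∂μ := by
    simp only [hμ, integral_c_mul_spinVar hF', Finset.sum_neg_distrib]
    rw [← integral_finsetSum _ fun x _ => hint x, localGenerator_eq_sum hF', Finset.mul_sum]
    simp only [Finset.sum_apply]
    rfl
  rw [e]
  have hFm : AEStronglyMeasurable F μ := hF.measurable.aestronglyMeasurable
  have hGm : AEStronglyMeasurable (K.localGenerator p F) μ := hB.measurable.aestronglyMeasurable
  have holder := eLpNorm_smul_le_mul_eLpNorm (p := 2) (q := 2) (r := 1) hGm hFm
  rw [eLpNorm_one_eq_lintegral_enorm] at holder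
  refine le_trans ?_ holder
  rw [← integral_neg]
  refine (ENNReal.ofReal_le_ofReal (le_abs_self _)).trans ?_
  rw [← Real.enorm_eq_ofReal_abs]
  refine (enorm_integral_le_lintegral_enorm _).trans_eq ?_
  simp

end KCSM

/-! ### The spectral gap -/

namespace KCSM

variable {d : ℕ} {K : KCSM d}

theorem IsGood.le_avg_goodInd {p : unitInterval} {ℓ : ℕ} {ε : ℝ} {G : Set (Config (block d ℓ))}
    (hG : K.IsGood p ℓ ε G) (y : Site d) (ω : Config (Site d)) :
    1 - ε ≤ avg (p : ℝ) (blockFinset ℓ y) (goodInd G y) ω := by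
  have hdep : DependsOn (goodInd G y) (blockFinset ℓ y : Set (Site d)) := by
    intro u u' h
    simp only [goodInd]
    rw [restrictBlock_congr fun v hv => h v hv]
  have hGm : MeasurableSet G := G.toFinite.measurableSet
  have hmeas : Measurable (restrictBlock (d := d) ℓ y) := by
    unfold restrictBlock; fun_prop
  have e : goodInd G y = fun ω => G.indicator (1 : Config (block d ℓ) → ℝ) (restrictBlock ℓ y ω) := by
    funext u
    by_cases h : restrictBlock ℓ y u ∈ G
    · rw [goodInd, if_pos h, Set.indicator_of_mem h, Pi.one_apply]
    · rw [goodInd, if_neg h, Set.indicator_of_notMem h]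
  rw [avg_eq_integral hdep subset_rfl, e, ← integral_map hmeas.aemeasurable
    (measurable_one.indicator hGm).aestronglyMeasurable, map_restrictBlock,
    integral_indicator_one hGm]
  exact hG.1

theorem IsGood.evariance_le_of_dependsOn {p : unitInterval} (hp0 : 0 < p) (hp1 : p < 1) {ℓ : ℕ}
    (hℓ : 0 < ℓ) {ε : ℝ} (hε0 : 0 ≤ ε) (hε : 4 * (2 ^ d * ε) * 2 ^ d ≤ 1)
    {G : Set (Config (block d ℓ))} (hG : K.IsGood p ℓ ε G) {A : Finset (Site d)}
    {F : Config (Site d) → ℝ} (hF : DependsOn F (A : Set (Site d))) :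
    ∃ W : Finset (Site d), evariance F (productLaw (Site d) p) ≤
      ENNReal.ofReal (4 * windowConst d ℓ p * 2 ^ d) * ∑ v ∈ W, K.siteEnergy p v F := by
  have h0 : 0 < (p : ℝ) := hp0
  have h1 : (p : ℝ) < 1 := hp1
  obtain ⟨W, hAW, hW⟩ := hG.fluct_le_of_dependsOn hℓ h0 h1 hε0 hε hG.le_avg_goodInd hF
  refine ⟨W, ?_⟩
  set μ := productLaw (Site d) p with hμ
  set C := 4 * windowConst d ℓ p * 2 ^ d with hC
  have hC0 : 0 ≤ C := by
    have := windowConst_nonneg d ℓ h0 h1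
    positivity
  have hFW : DependsOn F (W : Set (Site d)) := hF.mono (by exact_mod_cast hAW)
  have hvar : ∀ ω, fluct (p : ℝ) W W F ω = Var[F; μ] := by
    intro ω
    rw [fluct, avg_eq_integral ((hFW.sub (hFW.avg _ _)).pow 2) subset_rfl,
      variance_eq_integral hF.measurable.aemeasurable]
    simp only [Pi.pow_apply, Pi.sub_apply, avg_eq_integral hFW subset_rfl]
    rfl
  choose B hB using fun v => exists_dependsOn_c_mul_spinVar (K := K) hF (p : ℝ) v
  have hint : ∀ v, Integrable (avg (p : ℝ) W (K.c v * spinVar (p : ℝ) v F)) μ := fun v =>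
    ((hB v).avg _ _).integrable p
  -- The constraints may see spins outside W, so the pointwise inequality is integrated over ω; its
  -- left side is already constant.
  have hle : Var[F; μ] ≤ C * ∑ v ∈ W, ∫ ω, (K.c v * spinVar (p : ℝ) v F) ω ∂μ := by
    have : ∫ _, Var[F; μ] ∂μ ≤
        ∫ ω, C * ∑ v ∈ W, avg (p : ℝ) W (K.c v * spinVar (p : ℝ) v F) ω ∂μ :=
      integral_mono (integrable_const _)
        ((integrable_finsetSum _ fun v _ => hint v).const_mul _) fun ω => (hvar ω) ▸ hW ω
    rw [integral_const_mul, integral_finsetSum _ fun v _ => hint v] at this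
    simpa [hμ, integral_avg (hB _)] using this
  rw [← (hF.memLp 2 p).ofReal_variance_eq]
  refine (ENNReal.ofReal_le_ofReal hle).trans_eq ?_
  have hnonneg : ∀ v ∈ W, 0 ≤ ∫ ω, (K.c v * spinVar (p : ℝ) v F) ω ∂μ := fun v _ =>
    integral_nonneg fun ω => mul_nonneg (K.c_nonneg v ω) (spinVar_nonneg p.2.1 p.2.2 v F ω)
  rw [ENNReal.ofReal_mul hC0, ENNReal.ofReal_sum_of_nonneg hnonneg]
  simp only [siteEnergy_of_dependsOn hF]
  rfl

theorem dirichlet_eq_tsum (p : unitInterval) (f : Config (Site d) → ℝ) :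
    K.dirichlet p f = ∑' v, K.siteEnergy p v f := rfl

/-- The form evaluates f at updated configurations, so independence of the representative rests on
`ae_update_of_ae`. -/
theorem dirichlet_congr {p : unitInterval} (hp0 : 0 < p) (hp1 : p < 1)
    {f g : Config (Site d) → ℝ} (h : f =ᵐ[productLaw (Site d) p] g) :
    K.dirichlet p f = K.dirichlet p g := by
  simp only [dirichlet_eq_tsum, siteEnergy_eq]
  refine tsum_congr fun v => lintegral_congr_ae ?_
  filter_upwards [ae_update_of_ae hp0 hp1 v h 0, ae_update_of_ae hp0 hp1 v h 1] with ω h0 h1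
  rw [spinVar, spinVar, h0, h1]

/-- Insert F_m: the energy of F_n - F_m is bounded through the generator, that of F_m - f by |W|
times a squared norm. With W fixed the latter vanishes as m → ∞, leaving a bound uniform in W. -/
theorem sum_siteEnergy_sub_le {p : unitInterval} {f g : Config (Site d) → ℝ} (hf : Measurable f)
    (hf2 : MemLp f 2 (productLaw (Site d) p)) (hg2 : MemLp g 2 (productLaw (Site d) p))
    {F : ℕ → Config (Site d) → ℝ} (hF : ∀ n, IsLocal (F n))
    (hFf : Tendsto (fun n => eLpNorm (F n - f) 2 (productLaw (Site d) p)) atTop (𝓝 0))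
    (hLg : Tendsto (fun n => eLpNorm (K.localGenerator p (F n) - g) 2 (productLaw (Site d) p))
      atTop (𝓝 0)) (W : Finset (Site d)) (n : ℕ) :
    ∑ v ∈ W, K.siteEnergy p v (F n - f) ≤
      2 * (eLpNorm (F n - f) 2 (productLaw (Site d) p) *
        eLpNorm (K.localGenerator p (F n) - g) 2 (productLaw (Site d) p)) := by
  set μ := productLaw (Site d) p with hμ
  choose A hA using hF
  choose B hB using fun n => exists_dependsOn_localGenerator (K := K) (hA n) p
  set a : ℕ → ℝ≥0∞ := fun n => eLpNorm (F n - f) 2 μ with ha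
  set b : ℕ → ℝ≥0∞ := fun n => eLpNorm (K.localGenerator p (F n) - g) 2 μ with hb
  have hFm : ∀ n, MemLp (F n) 2 μ := fun n => (hA n).memLp 2 p
  have hLm : ∀ n, MemLp (K.localGenerator p (F n)) 2 μ := fun n => (hB n).memLp 2 p
  have han : a n ≠ ⊤ := ((hFm n).sub hf2).eLpNorm_ne_top
  have hbn : b n ≠ ⊤ := ((hLm n).sub hg2).eLpNorm_ne_top
  have key : ∀ m, ∑ v ∈ W, K.siteEnergy p v (F n - f) ≤
      2 * ((a n + a m) * (b n + b m)) + 2 * (W.card * a m ^ 2) := by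
    intro m
    have hm1 : Measurable (F n - F m) := (hA n).measurable.sub (hA m).measurable
    have hm2 : Measurable (F m - f) := (hA m).measurable.sub hf
    have e : F n - f = (F n - F m) + (F m - f) := by ring
    have h1 : ∑ v ∈ W, K.siteEnergy p v (F n - f) ≤
        2 * ∑ v ∈ W, K.siteEnergy p v (F n - F m) + 2 * ∑ v ∈ W, K.siteEnergy p v (F m - f) := by
      rw [Finset.mul_sum, Finset.mul_sum, ← Finset.sum_add_distrib, e]
      exact Finset.sum_le_sum fun v _ => siteEnergy_add_le p v hm1 _
    refine h1.trans ?_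
    have hAn : DependsOn (F n) ((A n ∪ A m : Finset (Site d)) : Set (Site d)) :=
      (hA n).mono (by simp)
    have hAm : DependsOn (F m) ((A n ∪ A m : Finset (Site d)) : Set (Site d)) :=
      (hA m).mono (by simp)
    gcongr
    · refine (sum_siteEnergy_le (hAn.sub hAm) p W).trans ?_
      rw [localGenerator_sub hAn hAm]
      gcongr
      · have e : F n - F m = (F n - f) - (F m - f) := by ring
        rw [e]
        exact eLpNorm_sub_le ((hFm n).sub hf2).aestronglyMeasurable
          ((hFm m).sub hf2).aestronglyMeasurable (by norm_num)
      · have e : K.localGenerator p (F n) - K.localGenerator p (F m) =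
            (K.localGenerator p (F n) - g) - (K.localGenerator p (F m) - g) := by ring
        rw [e]
        exact eLpNorm_sub_le ((hLm n).sub hg2).aestronglyMeasurable
          ((hLm m).sub hg2).aestronglyMeasurable (by norm_num)
    · refine (Finset.sum_le_card_nsmul _ _ _ fun v _ => siteEnergy_le p v hm2).trans_eq ?_
      rw [nsmul_eq_mul]
  have hlim : Tendsto (fun m => 2 * ((a n + a m) * (b n + b m)) + 2 * (W.card * a m ^ 2)) atTop
      (𝓝 (2 * ((a n + 0) * (b n + 0)) + 2 * (W.card * 0 ^ 2))) := by
    refine Tendsto.add ?_ ?_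
    · refine ENNReal.Tendsto.const_mul ?_ (Or.inr (by simp))
      exact ENNReal.Tendsto.mul (hFf.const_add _) (Or.inr (by simpa using hbn))
        (hLg.const_add _) (Or.inr (by simpa using han))
    · refine ENNReal.Tendsto.const_mul ?_ (Or.inr (by simp))
      exact ENNReal.Tendsto.const_mul (ENNReal.Tendsto.pow hFf) (Or.inr (by simp))
  have := ge_of_tendsto' hlim key
  simpa using this

/-- Approximate f by F_n in the graph norm. The set W depends on n, which is why the energy of F_n -
f must be small uniformly in W. One factor 2 comes from the variance, the other from the energy. -/
theorem evariance_le_mul_dirichlet {p : unitInterval} {C : ℝ≥0∞} (hC : C ≠ ⊤)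
    (hpoin : ∀ (A : Finset (Site d)) (F : Config (Site d) → ℝ), DependsOn F (A : Set (Site d)) →
      ∃ W : Finset (Site d), evariance F (productLaw (Site d) p) ≤
        C * ∑ v ∈ W, K.siteEnergy p v F)
    {f g : Config (Site d) → ℝ} (hf : Measurable f) (hfg : K.IsGenerator p f g) :
    evariance f (productLaw (Site d) p) ≤ 4 * C * K.dirichlet p f := by
  obtain ⟨hf2, hg2, F, hF, hFf, hLg⟩ := hfg
  set μ := productLaw (Site d) p with hμ
  set a : ℕ → ℝ≥0∞ := fun n => eLpNorm (F n - f) 2 μ with ha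
  set b : ℕ → ℝ≥0∞ := fun n => eLpNorm (K.localGenerator p (F n) - g) 2 μ with hb
  have key : ∀ n, evariance f μ ≤
      2 * (C * (2 * K.dirichlet p f + 2 * (2 * (a n * b n)))) + 2 * a n ^ 2 := by
    intro n
    obtain ⟨A, hA⟩ := hF n
    obtain ⟨W, hW⟩ := hpoin A (F n) hA
    have hFm : MemLp (F n) 2 μ := hA.memLp 2 p
    have h1 : evariance f μ ≤ 2 * evariance (F n) μ + 2 * a n ^ 2 := by
      have h2 : (2 : ℝ≥0∞) = ENNReal.ofReal 2 := by simp
      rw [← hf2.ofReal_variance_eq, ← hFm.ofReal_variance_eq, ha]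
      simp only
      rw [← lintegral_ofReal_sq, ← ofReal_integral_eq_lintegral_ofReal
        (hFm.sub hf2).integrable_sq (ae_of_all _ fun _ => sq_nonneg _), h2,
        ← ENNReal.ofReal_mul (by norm_num), ← ENNReal.ofReal_mul (by norm_num),
        ← ENNReal.ofReal_add (mul_nonneg (by norm_num) (variance_nonneg _ _))
          (mul_nonneg (by norm_num) (integral_nonneg fun _ => sq_nonneg _))]
      exact ENNReal.ofReal_le_ofReal (variance_le_two_mul_add hf2 hFm)
    refine h1.trans ?_
    gcongr
    refine hW.trans ?_
    gcongr
    have e : F n = f + (F n - f) := by ring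
    calc ∑ v ∈ W, K.siteEnergy p v (F n)
        ≤ ∑ v ∈ W, (2 * K.siteEnergy p v f + 2 * K.siteEnergy p v (F n - f)) :=
          Finset.sum_le_sum fun v _ => by
            conv_lhs => rw [e]
            exact siteEnergy_add_le p v hf _
      _ = 2 * ∑ v ∈ W, K.siteEnergy p v f + 2 * ∑ v ∈ W, K.siteEnergy p v (F n - f) := by
          rw [Finset.sum_add_distrib, Finset.mul_sum, Finset.mul_sum]
      _ ≤ _ := by
          gcongr
          · exact ENNReal.sum_le_tsum W
          · exact sum_siteEnergy_sub_le hf hf2 hg2 hF hFf hLg W n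
  have hlim : Tendsto (fun n => 2 * (C * (2 * K.dirichlet p f + 2 * (2 * (a n * b n)))) +
      2 * a n ^ 2) atTop
      (𝓝 (2 * (C * (2 * K.dirichlet p f + 2 * (2 * (0 * 0)))) + 2 * 0 ^ 2)) := by
    refine Tendsto.add ?_ (ENNReal.Tendsto.const_mul (ENNReal.Tendsto.pow hFf) (Or.inr (by simp)))
    refine ENNReal.Tendsto.const_mul (ENNReal.Tendsto.const_mul ?_ (Or.inr hC)) (Or.inr (by simp))
    refine Tendsto.const_add _ (ENNReal.Tendsto.const_mul (ENNReal.Tendsto.const_mul ?_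
      (Or.inr (by simp))) (Or.inr (by simp)))
    exact ENNReal.Tendsto.mul hFf (by simp) hLg (by simp)
  refine (ge_of_tendsto' hlim key).trans_eq ?_
  ring

theorem gap_pos_of_poincare {p : unitInterval} (hp0 : 0 < p) (hp1 : p < 1) {C : ℝ≥0∞} (hC : C ≠ ⊤)
    (hpoin : ∀ (A : Finset (Site d)) (F : Config (Site d) → ℝ), DependsOn F (A : Set (Site d)) →
      ∃ W : Finset (Site d), evariance F (productLaw (Site d) p) ≤
        C * ∑ v ∈ W, K.siteEnergy p v F) : 0 < K.gap p := by
  have hC4 : 4 * C ≠ ⊤ := ENNReal.mul_ne_top (by simp) hC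
  refine (ENNReal.inv_pos.2 hC4).trans_le (le_iInf₂ fun f hf => ?_)
  obtain ⟨⟨g, hfg⟩, hconst⟩ := hf
  have hfm := hfg.1.aestronglyMeasurable
  have hvar0 : evariance f (productLaw (Site d) p) ≠ 0 := fun h =>
    hconst ⟨_, (evariance_eq_zero_iff hfm.aemeasurable).1 h⟩
  have hvar1 := evariance_ne_top hfg.1
  rw [ENNReal.le_div_iff_mul_le (Or.inl hvar0) (Or.inl hvar1)]
  rw [mul_comm, ← div_eq_mul_inv]
  refine ENNReal.div_le_of_le_mul' ?_
  -- Pass to a measurable representative, as required to split integrals of energies.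
  obtain ⟨f', hf', hff'⟩ := hfm
  rw [evariance_congr hff', dirichlet_congr hp0 hp1 hff']
  refine evariance_le_mul_dirichlet (g := g) hC hpoin hf'.measurable ?_
  obtain ⟨h1, h2, F, hF, h3, h4⟩ := hfg
  refine ⟨(memLp_congr_ae hff').1 h1, h2, F, hF, ?_, h4⟩
  have : ∀ n, eLpNorm (F n - f') 2 (productLaw (Site d) p) =
      eLpNorm (F n - f) 2 (productLaw (Site d) p) := fun n =>
    eLpNorm_congr_ae (EventuallyEq.rfl.sub hff'.symm)
  simpa only [this] using h3

end KCSM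

theorem mainTheorem1 (d : ℕ) (hd : 1 ≤ d) :
    ∃ ε₀ : ℝ, 0 < ε₀ ∧ ε₀ < 1 ∧
      ∀ (K : KCSM d) (q : unitInterval), 0 < q → q < 1 →
        (∃ ℓ : ℕ, K.range < ℓ ∧ ∃ G : Set (Config (block d ℓ)), K.IsGood q ℓ ε₀ G) →
          0 < K.gap q := by
  have h4 : (4 : ℝ) ^ d = 2 ^ d * 2 ^ d := by rw [← mul_pow]; norm_num
  -- This makes 4 · (2^d ε) · 2^d equal to 1: one 2^d is the union bound over neighbours, the other
  -- the multiplicity of a block among neighbourhoods.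
  refine ⟨(4 * 4 ^ d)⁻¹, by positivity, inv_lt_one_of_one_lt₀ ?_, ?_⟩
  · have : (1 : ℝ) ≤ 4 ^ d := one_le_pow₀ (by norm_num)
    linarith
  · rintro K q hq0 hq1 ⟨ℓ, hℓ, G, hG⟩
    refine KCSM.gap_pos_of_poincare hq0 hq1
      (C := ENNReal.ofReal (4 * KCSM.windowConst d ℓ q * 2 ^ d)) ENNReal.ofReal_ne_top
      fun A F hF => hG.evariance_le_of_dependsOn hq0 hq1 (by omega) (by positivity) ?_ hF
    rw [h4]
    refine le_of_eq ?_
    field_simp
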